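/- Let $F$ be a field of characteristic different from $2$ and let $Q=(c,d)_F$ be a quaternion division algebra over $F$, with canonical involution $\bar{\phantom{x}}$. For $a\in F^\times$ put $$G_+(a)=\{\mu\in F^\times \mid (a,\mu)_F \text{ is split}\},\qquad G_-(a)=\{\mu\in F^\times\mid (a,\mu)_F\cong Q\}.$$ Let $n\ge 3$, let $q_1,\dots,q_n\in Q$ be pure quaternions with squares $q_i^2=a_i\in F^\times$, let $\widehat F=F((t_1))\cdots((t_n))$ be the field of iterated Laurent series, let $\widehat Q=Q\otimes_F\widehat F$ with the involution $\bar{\phantom{x}}\otimes\mathrm{Id}_{\widehat F}$, and let $\sigma$ be the involution on $A=M_n(\widehat Q)$ adjoint to the skew-hermitian form $\langle t_1q_1,\dots,t_nq_n\rangle$, $(x,y)\mapsto\sum_i \overline{x_i}\,t_iq_i\,y_i$, on $\widehat Q^n$. A similitude of $\sigma$ is an element $g\in A^\times$ with $\sigma(g)g=\mu\in\widehat F^\times$; it is improper if its reduced norm is $\mathrm{Nrd}_A(g)=-\mu^n$, and square-central if $g^2$ is in the center of $A$. The discriminant $\operatorname{disc}\sigma$ is the square class $(-1)^n\,\mathrm{Nrd}_A(x)\,\widehat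 F^{\times 2}$ of any $x\in A^\times$ with $\sigma(x)=-x$. Then: 1. $\operatorname{disc}\sigma=a_1\cdots a_n\cdot\widehat F^{\times2}$ (that is, invertible skew-symmetric elements $x$ exist and each of them gives this square class). 2. $\sigma$ admits improper similitudes if and only if there are $\varepsilon_1,\dots,\varepsilon_n\in\{\pm1\}$ with $\varepsilon_1\cdots\varepsilon_n=-1$ and $G_{\varepsilon_1}(a_1)\cap\dots\cap G_{\varepsilon_n}(a_n)\ne\varnothing$. 3. $\sigma$ admits square-central improper similitudes if and only if $n$ is odd and $G_-(a_1)\cap\dots\cap G_-(a_n)\neq\varnothing$. -/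

import Mathlib

open scoped Quaternion TensorProduct

universe u

namespace GenericSum

noncomputable section

/-! ### Iterated Laurent series -/

/-- The underlying recursion for `F((t₁))…((tₙ))`: start with `F` and adjoin one Laurent series
variable at a time, `F((t₁))…((tₙ₊₁)) = (F((t₁))…((tₙ)))((tₙ₊₁))`. -/
def iteratedLaurentAux (F : Type u) [Field F] : ℕ → Σ K : Type u, Field K
  | 0 => ⟨F, inferInstance⟩
  | n + 1 =>
    letI := (iteratedLaurentAux F n).2
    ⟨LaurentSeries (iteratedLaurentAux F n).1, inferInstance⟩

/-- The field `F((t₁))…((tₙ))` of iterated Laurent series in `n` indeterminates over `F`. -/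
def IteratedLaurent (F : Type u) [Field F] (n : ℕ) : Type u := (iteratedLaurentAux F n).1

instance IteratedLaurent.instField (F : Type u) [Field F] (n : ℕ) :
    Field (IteratedLaurent F n) := (iteratedLaurentAux F n).2

theorem IteratedLaurent.zero_eq (F : Type u) [Field F] : IteratedLaurent F 0 = F := rfl

theorem IteratedLaurent.succ_eq (F : Type u) [Field F] (n : ℕ) :
    IteratedLaurent F (n + 1) = LaurentSeries (IteratedLaurent F n) := rfl

/-- The inclusion `F((t₁))…((tₙ)) → F((t₁))…((tₙ₊₁))` as constant Laurent series. -/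
def IteratedLaurent.const (F : Type u) [Field F] (n : ℕ) :
    IteratedLaurent F n →+* IteratedLaurent F (n + 1) :=
  (HahnSeries.C : IteratedLaurent F n →+* LaurentSeries (IteratedLaurent F n))

/-- The inclusion `F → F((t₁))…((tₙ))`. -/
def IteratedLaurent.embed (F : Type u) [Field F] : (n : ℕ) → F →+* IteratedLaurent F n
  | 0 => RingHom.id F
  | n + 1 => (IteratedLaurent.const F n).comp (IteratedLaurent.embed F n)

instance IteratedLaurent.instAlgebra (F : Type u) [Field F] (n : ℕ) :
    Algebra F (IteratedLaurent F n) := (IteratedLaurent.embed F n).toAlgebra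

/-- The newest indeterminate `tₙ₊₁` of `F((t₁))…((tₙ₊₁))`. -/
def IteratedLaurent.newVar (F : Type u) [Field F] (n : ℕ) : IteratedLaurent F (n + 1) :=
  (HahnSeries.single (1 : ℤ) (1 : IteratedLaurent F n) : LaurentSeries (IteratedLaurent F n))

/-- The indeterminates `t₁, …, tₙ` of `F((t₁))…((tₙ))` (numbered from `0`). -/
def IteratedLaurent.t (F : Type u) [Field F] : (n : ℕ) → Fin n → IteratedLaurent F n
  | 0 => Fin.elim0
  | n + 1 => Fin.snoc (α := fun _ => IteratedLaurent F (n + 1))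
      (fun i => IteratedLaurent.const F n (IteratedLaurent.t F n i)) (IteratedLaurent.newVar F n)

theorem IteratedLaurent.t_ne_zero (F : Type u) [Field F] (n : ℕ) (i : Fin n) :
    IteratedLaurent.t F n i ≠ 0 := by
  induction n with
  | zero => exact i.elim0
  | succ n ih =>
    refine Fin.lastCases ?_ (fun j => ?_) i
    · simp only [IteratedLaurent.t, Fin.snoc_last]
      exact HahnSeries.single_ne_zero (Γ := ℤ) (a := 1) (one_ne_zero (α := IteratedLaurent F n))
    · simp only [IteratedLaurent.t, Fin.snoc_castSucc]
      exact (map_ne_zero _).2 (ih j)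

/-! ### Reduced norm -/

/-- The degree of a central simple `K`-algebra: the square root of its dimension. -/
def degree (K : Type u) (A : Type*) [Field K] [Ring A] [Algebra K A] : ℕ :=
  Nat.sqrt (Module.finrank K A)

open Classical in
/-- The reduced norm of a central simple `K`-algebra `A` of degree `d`: the common value
of `det (φ x)`, an element of `K`, over all the splittings of `A` by an algebraic closure,
i.e. over all the `K`-algebra homomorphisms `φ` from `A` to `d × d` matrices
over an algebraic closure of `K`. -/
def reducedNorm (K : Type u) {A : Type*} [Field K] [Ring A] [Algebra K A] (x : A) : K :=
  if h : ∃ r : K, ∀ φ : A →ₐ[K] Matrix (Fin (degree K A)) (Fin (degree K A)) (AlgebraicClosure K),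
      (φ x).det = algebraMap K (AlgebraicClosure K) r
  then h.choose else 0

/-! ### Similitudes and discriminant of an orthogonal involution, characteristic not two -/

/-- `g` is a similitude of `(A, σ)` with multiplier `μ`. -/
def IsSimilitude (K : Type u) {A : Type*} [Field K] [Ring A] [Algebra K A] (σ : A → A)
    (g : Aˣ) (μ : Kˣ) : Prop :=
  σ (g : A) * (g : A) = algebraMap K A μ

/-- An improper similitude of `(A, σ)`, `deg A = 2m`: a similitude `g` with multiplier `μ`
such that `Nrd g = - μ ^ m`. -/
def IsImproperSimilitude (K : Type u) {A : Type*} [Field K] [Ring A] [Algebra K A] (σ : A → A)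
    (g : Aˣ) : Prop :=
  ∃ μ : Kˣ, IsSimilitude K σ g μ ∧ reducedNorm K (g : A) = -(μ : K) ^ (degree K A / 2)

/-- `g` is square-central: `g ^ 2` lies in the center of `A`. -/
def IsSquareCentral {A : Type*} [Ring A] (g : Aˣ) : Prop :=
  (g : A) ^ 2 ∈ Subring.center A

/-- The square class `c · K^{×2}`. -/
def squareClass {K : Type u} [Field K] (c : K) : Set K :=
  {x | ∃ z : K, z ≠ 0 ∧ x = c * z ^ 2}

/-- The discriminant of an orthogonal involution `σ` on `A`, `deg A = 2m`: the square class of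
`(-1) ^ m Nrd x`, for `x` an invertible `σ`-skew-symmetric element. As a subset of `K` it is the
union of these classes over all such `x`; so an equality
`discriminant K σ = squareClass c` says that such an `x` exists, and that each of them has
`(-1) ^ m Nrd x` in the square class of `c`. -/
def discriminant (K : Type u) {A : Type*} [Field K] [Ring A] [Algebra K A] (σ : A → A) : Set K :=
  ⋃ x ∈ {x : A | IsUnit x ∧ σ x = -x},
    squareClass ((-1) ^ (degree K A / 2) * reducedNorm K x)

/-! ### The sets `G₊(a)` and `G₋(a)` -/

/-- `G_ε(a)`, relative to the quaternion algebra `Q = (c, d)_F`: `G₊(a)` is the set of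
`μ ∈ Fˣ` such that `(a, μ)_F` is split, and `G₋(a)` the set of `μ ∈ Fˣ` such that
`(a, μ)_F` is isomorphic to `Q`. -/
def G {F : Type u} [Field F] (c d : F) (ε : ℤˣ) (a : Fˣ) : Set Fˣ :=
  if ε = 1 then {μ | Nonempty (ℍ[F, (a : F), (μ : F)] ≃ₐ[F] Matrix (Fin 2) (Fin 2) F)}
  else {μ | Nonempty (ℍ[F, (a : F), (μ : F)] ≃ₐ[F] ℍ[F, c, d])}

/-! ### The diagonal skew-hermitian form and its adjoint involution -/

/-- The scalar extension `Q ⊗_F F((t₁))…((tₙ))` of the quaternion algebra `Q = (c, d)_F`,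
with the field of scalars written on the left. -/
def QHat {F : Type u} [Field F] (c d : F) (n : ℕ) : Type u :=
  IteratedLaurent F n ⊗[F] ℍ[F, c, d]

instance QHat.instRing {F : Type u} [Field F] (c d : F) (n : ℕ) : Ring (QHat c d n) :=
  inferInstanceAs (Ring (IteratedLaurent F n ⊗[F] ℍ[F, c, d]))

instance QHat.instAlgebra {F : Type u} [Field F] (c d : F) (n : ℕ) :
    Algebra (IteratedLaurent F n) (QHat c d n) :=
  inferInstanceAs (Algebra (IteratedLaurent F n) (IteratedLaurent F n ⊗[F] ℍ[F, c, d]))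

/-- The pure tensor `r ⊗ p` in `QHat`. -/
def QHat.tmul {F : Type u} [Field F] {c d : F} {n : ℕ} (r : IteratedLaurent F n)
    (p : ℍ[F, c, d]) : QHat c d n :=
  (r ⊗ₜ[F] p : IteratedLaurent F n ⊗[F] ℍ[F, c, d])

theorem QHat.tmul_mul_tmul {F : Type u} [Field F] {c d : F} {n : ℕ} (r s : IteratedLaurent F n)
    (p p' : ℍ[F, c, d]) :
    (QHat.tmul r p * QHat.tmul s p' : QHat c d n) = QHat.tmul (r * s) (p * p') :=
  Algebra.TensorProduct.tmul_mul_tmul r s p p'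

theorem QHat.one_eq {F : Type u} [Field F] (c d : F) (n : ℕ) :
    (1 : QHat c d n) = QHat.tmul 1 1 := rfl

theorem QHat.tmul_neg {F : Type u} [Field F] {c d : F} {n : ℕ} (r : IteratedLaurent F n)
    (p : ℍ[F, c, d]) : (QHat.tmul r (-p) : QHat c d n) = -QHat.tmul r p :=
  TensorProduct.tmul_neg (R := F) r p

theorem QHat.induction {F : Type u} [Field F] {c d : F} {n : ℕ} {P : QHat c d n → Prop}
    (zero : P 0) (tmul : ∀ r p, P (QHat.tmul r p)) (add : ∀ x y, P x → P y → P (x + y))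
    (x : QHat c d n) : P x :=
  TensorProduct.induction_on (R := F) x zero tmul add

/-- The canonical involution (quaternion conjugation) of `(c, d)_F` as an `F`-linear map. -/
def conj {F : Type u} [Field F] (c d : F) : ℍ[F, c, d] →ₗ[F] ℍ[F, c, d] where
  toFun := star
  map_add' := star_add
  map_smul' r x := by ext <;> simp

/-- The involution `conj ⊗ Id` on `Q ⊗_F F((t₁))…((tₙ))`. -/
def conjHat {F : Type u} [Field F] (c d : F) (n : ℕ) :
    QHat c d n →ₗ[IteratedLaurent F n] QHat c d n :=
  ((conj c d).baseChange (IteratedLaurent F n) :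
    IteratedLaurent F n ⊗[F] ℍ[F, c, d] →ₗ[IteratedLaurent F n]
      IteratedLaurent F n ⊗[F] ℍ[F, c, d])

theorem conjHat_tmul {F : Type u} [Field F] {c d : F} {n : ℕ} (r : IteratedLaurent F n)
    (p : ℍ[F, c, d]) : conjHat c d n (QHat.tmul r p) = QHat.tmul r (star p) := rfl

/-- The element `tᵢ qᵢ` of `Q ⊗_F F((t₁))…((tₙ))`. -/
def coeff {F : Type u} [Field F] {c d : F} {n : ℕ} (q : Fin n → ℍ[F, c, d]) (i : Fin n) :
    QHat c d n :=
  QHat.tmul (IteratedLaurent.t F n i) (q i)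

/-- The skew-hermitian form `⟨t₁q₁, …, tₙqₙ⟩` on the right vector space of column vectors:
`h(x, y) = ∑ i, conj(xᵢ) tᵢ qᵢ yᵢ`. -/
def form {F : Type u} [Field F] {c d : F} {n : ℕ} (q : Fin n → ℍ[F, c, d])
    (x y : Fin n → QHat c d n) : QHat c d n :=
  ∑ i, conjHat c d n (x i) * coeff q i * y i

/-- The involution on `n × n` matrices adjoint to `⟨t₁q₁, …, tₙqₙ⟩`, i.e. `g ↦ D⁻¹ g* D`
with `D = diag(t₁q₁, …, tₙqₙ)` and `g*` the conjugate transpose. It is the adjoint for `form q`,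
see `form_mulVec_left_iff`. -/
def adjointInvolution {F : Type u} [Field F] {c d : F} {n : ℕ} (q : Fin n → ℍ[F, c, d])
    (g : Matrix (Fin n) (Fin n) (QHat c d n)) : Matrix (Fin n) (Fin n) (QHat c d n) :=
  Matrix.of fun i j => Ring.inverse (coeff q i) * conjHat c d n (g j i) * coeff q j

theorem conjHat_mul {F : Type u} [Field F] (c d : F) (n : ℕ) (x y : QHat c d n) :
    conjHat c d n (x * y) = conjHat c d n y * conjHat c d n x := by
  induction x using QHat.induction with
  | zero => rw [zero_mul, map_zero, mul_zero]
  | add x₁ x₂ h₁ h₂ => rw [add_mul, map_add, map_add, mul_add, h₁, h₂]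
  | tmul r p =>
    induction y using QHat.induction with
    | zero => rw [mul_zero, map_zero, zero_mul]
    | add x₁ x₂ h₁ h₂ => rw [mul_add, map_add, map_add, add_mul, h₁, h₂]
    | tmul s p' =>
      rw [QHat.tmul_mul_tmul, conjHat_tmul, conjHat_tmul, conjHat_tmul, QHat.tmul_mul_tmul,
        star_mul, mul_comm r]

theorem conjHat_conjHat {F : Type u} [Field F] (c d : F) (n : ℕ) (x : QHat c d n) :
    conjHat c d n (conjHat c d n x) = x := by
  induction x using QHat.induction with
  | zero => rw [map_zero, map_zero]
  | add x₁ x₂ h₁ h₂ => rw [map_add, map_add, h₁, h₂]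
  | tmul r p => rw [conjHat_tmul, conjHat_tmul, star_star]

theorem conjHat_one {F : Type u} [Field F] (c d : F) (n : ℕ) :
    conjHat c d n 1 = 1 := by
  rw [QHat.one_eq, conjHat_tmul, star_one]

theorem conjHat_coeff {F : Type u} [Field F] {c d : F} {n : ℕ} (q : Fin n → ℍ[F, c, d])
    (hq : ∀ i, (q i).re = 0) (i : Fin n) : conjHat c d n (coeff q i) = -coeff q i := by
  have : star (q i) = -q i := by ext <;> simp [hq i]
  rw [coeff, conjHat_tmul, this, QHat.tmul_neg]

theorem isUnit_coeff {F : Type u} [Field F] {c d : F} {n : ℕ} (q : Fin n → ℍ[F, c, d])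
    (hq : ∀ i, IsUnit (q i)) (i : Fin n) : IsUnit (coeff q i) := by
  obtain ⟨u, hu⟩ := hq i
  have ht := IteratedLaurent.t_ne_zero F n i
  refine ⟨⟨coeff q i, QHat.tmul (IteratedLaurent.t F n i)⁻¹ (↑u⁻¹ : ℍ[F, c, d]), ?_, ?_⟩, rfl⟩
  · rw [coeff, QHat.tmul_mul_tmul, ← hu, mul_inv_cancel₀ ht, Units.mul_inv, QHat.one_eq]
  · rw [coeff, QHat.tmul_mul_tmul, ← hu, inv_mul_cancel₀ ht, Units.inv_mul, QHat.one_eq]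

/-- `adjointInvolution q g` is the adjoint of `g` for `form q`, and is the only one. -/
theorem form_mulVec_left_iff {F : Type u} [Field F] {c d : F} {n : ℕ} (q : Fin n → ℍ[F, c, d])
    (hpure : ∀ i, (q i).re = 0) (hq : ∀ i, IsUnit (q i))
    (g g' : Matrix (Fin n) (Fin n) (QHat c d n)) :
    (∀ x y : Fin n → QHat c d n, form q (g'.mulVec x) y = form q x (g.mulVec y)) ↔
      g' = adjointInvolution q g := by
  have key : ∀ i j, conjHat c d n (adjointInvolution q g i j) * coeff q i =
      coeff q j * g j i := by
    intro i j
    have hi := isUnit_coeff q hq i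
    have h1 : conjHat c d n (Ring.inverse (coeff q i)) * coeff q i = -1 := by
      have := congrArg (conjHat c d n) (Ring.mul_inverse_cancel _ hi)
      rw [conjHat_mul, conjHat_coeff q hpure] at this
      rw [conjHat_one, mul_neg] at this
      exact neg_eq_iff_eq_neg.mp this
    rw [show adjointInvolution q g i j =
      Ring.inverse (coeff q i) * conjHat c d n (g j i) * coeff q j from rfl]
    rw [conjHat_mul, conjHat_mul, conjHat_conjHat, conjHat_coeff q hpure, mul_assoc, mul_assoc,
      h1, mul_neg, mul_one, neg_mul_neg]
  constructor
  · intro h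
    ext i j
    have h1 := h (Pi.single j 1) (Pi.single i 1)
    have hc : ∀ (M : Matrix (Fin n) (Fin n) (QHat c d n)) (k l : Fin n),
        M.mulVec (Pi.single k 1) l = M l k := by
      intro M k l
      rw [Matrix.mulVec, dotProduct, Finset.sum_eq_single k] <;>
        simp +contextual
    simp only [form, hc] at h1
    rw [Finset.sum_eq_single i (by intro b _ hb; simp [hb]) (by simp),
      Finset.sum_eq_single j (by intro b _ hb; simp [hb]) (by simp)] at h1
    simp only [Pi.single_eq_same, conjHat_one, one_mul, mul_one] at h1
    rw [← key i j] at h1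
    have h2 := (isUnit_coeff q hq i).mul_right_cancel h1
    simpa [conjHat_conjHat] using congrArg (conjHat c d n) h2
  · rintro rfl x y
    simp only [form, Matrix.mulVec, dotProduct, map_sum, conjHat_mul, Finset.sum_mul,
      Finset.mul_sum]
    rw [Finset.sum_comm]
    refine Finset.sum_congr rfl fun j _ => Finset.sum_congr rfl fun i _ => ?_
    rw [mul_assoc (conjHat c d n (x j)), key]
    simp only [mul_assoc]

end

end GenericSum

/-! The discriminant comes from a hermitian trick. With `D = diag(t₁q₁, …, tₙqₙ)`, a matrix `x` is
`σ`-skew exactly when `D x` is hermitian for the conjugate transpose, and the reduced norm of a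
hermitian quaternionic matrix is a square (`exists_nrd_hermitian`). Since `Nrd D = ∏ tᵢ² (-aᵢ)`, the
class of `(-1)ⁿ Nrd x` is that of `∏ aᵢ`.

For similitudes, the rank one case decides everything. If `ū q u = m q` with `q² = a`, then `Nrd u =
±m`. With the plus sign `u` commutes with `q`, so `m` is a norm from `F(q)` and `(a, m)` is split;
with the minus sign `u` anticommutes with `q` and `u² = m`, so `q` and `u` generate a copy of `(a,
m)` in `Q`. Both implications reverse (`mem_G_of_similitude`, `exists_similitude_of_mem_G`). Hence a
common `m` in the sets `G` with signs of product `-1` gives the improper similitude `diag(u₁, …,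
uₙ)`, which squares to `m` if all the signs are `-1`.

Conversely, similitudes are reduced to `F` one indeterminate at a time, in the style of Springer's
theorem. Over `K((t))` the form is `D ⊥ ⟨t q⟩` with `D` and `q` defined over `K` and anisotropic. A
similitude whose multiplier has even order is rescaled until the multiplier is a unit; by anisotropy
it is then integral over `K[[t]]`, and modulo `t` it is block triangular. Its diagonal blocks are
similitudes of `D` and of `⟨q⟩` with the same multiplier, and their reduced norms multiply to the
residue of that of the similitude (`IsSim.residue`). The order is even as soon as `D` has rank at
least `2`, or a rank one form over `K` has a similitude with the same multiplier. The induction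
(`HasResidues`) therefore carries along a family of rank one forms, to which each step adds one; `n
≥ 3` is what starts it. At the bottom there remain `uᵢ` in `Q` with a common multiplier and signs of
product `-1`.

A relation `g² = l` survives the reduction, so in the square-central case all `uᵢ²` equal one
scalar. This excludes mixed signs (`sign_eq_neg_one`), so every sign is `-1` and `(-1)ⁿ = -1`. -/

namespace GenericSum

/-! ### Quaternion algebras over commutative rings: functoriality and norm -/

section Quaternion

variable {R S : Type*} [CommRing R] [CommRing S]

/-- The ring homomorphism `(c, d)_R → (f c, f d)_S` induced by `f : R → S`. -/
def qmap (f : R →+* S) {c d : R} {c' d' : S} (hc : f c = c') (hd : f d = d') :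
    ℍ[R, c, d] →+* ℍ[S, c', d'] where
  toFun x := ⟨f x.re, f x.imI, f x.imJ, f x.imK⟩
  map_one' := by ext <;> simp
  map_zero' := by ext <;> simp
  map_add' x y := by ext <;> simp
  map_mul' x y := by subst hc hd; ext <;> simp

section

variable (f : R →+* S) {c d : R} {c' d' : S} (hc : f c = c') (hd : f d = d')

@[simp] theorem qmap_re (x : ℍ[R, c, d]) : (qmap f hc hd x).re = f x.re := rfl
@[simp] theorem qmap_imI (x : ℍ[R, c, d]) : (qmap f hc hd x).imI = f x.imI := rfl
@[simp] theorem qmap_imJ (x : ℍ[R, c, d]) : (qmap f hc hd x).imJ = f x.imJ := rfl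
@[simp] theorem qmap_imK (x : ℍ[R, c, d]) : (qmap f hc hd x).imK = f x.imK := rfl

theorem qmap_star (x : ℍ[R, c, d]) : qmap f hc hd (star x) = star (qmap f hc hd x) := by
  ext <;> simp

theorem qmap_smul (r : R) (x : ℍ[R, c, d]) : qmap f hc hd (r • x) = f r • qmap f hc hd x := by
  ext <;> simp

theorem qmap_algebraMap (r : R) :
    qmap f hc hd (algebraMap R _ r) = algebraMap S ℍ[S, c', d'] (f r) := by
  ext <;> simp [QuaternionAlgebra.algebraMap_eq]

theorem qmap_injective (hf : Function.Injective f) : Function.Injective (qmap f hc hd) := by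
  intro x y h
  have h1 := congrArg QuaternionAlgebra.re h
  have h2 := congrArg QuaternionAlgebra.imI h
  have h3 := congrArg QuaternionAlgebra.imJ h
  have h4 := congrArg QuaternionAlgebra.imK h
  ext
  exacts [hf h1, hf h2, hf h3, hf h4]

end

variable {c d : R}

/-- The reduced norm of a quaternion. -/
def qnorm (x : ℍ[R, c, d]) : R := x.re ^ 2 - c * x.imI ^ 2 - d * x.imJ ^ 2 + c * d * x.imK ^ 2

theorem star_mul_self_eq (x : ℍ[R, c, d]) : star x * x = algebraMap R _ (qnorm x) := by
  ext <;> simp [qnorm, QuaternionAlgebra.algebraMap_eq] <;> ring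

theorem self_mul_star_eq (x : ℍ[R, c, d]) : x * star x = algebraMap R _ (qnorm x) := by
  ext <;> simp [qnorm, QuaternionAlgebra.algebraMap_eq] <;> ring

theorem qnorm_mul (x y : ℍ[R, c, d]) : qnorm (x * y) = qnorm x * qnorm y := by
  simp [qnorm]; ring

theorem qnorm_star (x : ℍ[R, c, d]) : qnorm (star x) = qnorm x := by
  simp [qnorm]

theorem qnorm_neg (x : ℍ[R, c, d]) : qnorm (-x) = qnorm x := by
  simp [qnorm]

theorem qnorm_smul (r : R) (x : ℍ[R, c, d]) : qnorm (r • x) = r ^ 2 * qnorm x := by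
  simp [qnorm]; ring

theorem qnorm_algebraMap (r : R) : qnorm (algebraMap R ℍ[R, c, d] r) = r ^ 2 := by
  simp [qnorm, QuaternionAlgebra.algebraMap_eq]

@[simp] theorem qnorm_zero : qnorm (0 : ℍ[R, c, d]) = 0 := by simp [qnorm]

@[simp] theorem qnorm_one : qnorm (1 : ℍ[R, c, d]) = 1 := by simp [qnorm]

theorem qnorm_qmap (f : R →+* S) {c' d' : S} (hc : f c = c') (hd : f d = d') (x : ℍ[R, c, d]) :
    qnorm (qmap f hc hd x) = f (qnorm x) := by
  subst hc hd; simp [qnorm]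

theorem star_eq_neg_of_re_eq_zero {x : ℍ[R, c, d]} (hx : x.re = 0) : star x = -x := by
  ext <;> simp [hx]

theorem mul_self_of_re_eq_zero {x : ℍ[R, c, d]} (hx : x.re = 0) :
    x * x = -algebraMap R _ (qnorm x) := by
  rw [← star_mul_self_eq, star_eq_neg_of_re_eq_zero hx, neg_mul, neg_neg]

end Quaternion

/-! ### The reduced norm of matrices over a quaternion algebra -/

section NormDef

variable {R S : Type*} [CommRing R] [CommRing S] {c d : R}

/-- The ring homomorphism out of `R[√c]` determined by a square root of `c`. -/
def quadLift (f : R →+* S) (s : S) (hs : s * s = f c) : QuadraticAlgebra R c 0 →+* S where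
  toFun z := f z.re + f z.im * s
  map_one' := by simp [QuadraticAlgebra.re_one, QuadraticAlgebra.im_one]
  map_zero' := by simp
  map_add' x y := by simp; ring
  map_mul' x y := by
    simp
    linear_combination -f x.im * f y.im * hs

variable (c) in
/-- The square root of `c` in `R[√c]`. -/
def quadRoot : QuadraticAlgebra R c 0 := ⟨0, 1⟩

theorem quadRoot_mul_self : quadRoot c * quadRoot c = algebraMap R _ c := by
  ext <;> simp [quadRoot]

/-- The splitting of `(c, d)_R` over `R[√c]`. -/
def splitHom : ℍ[R, c, d] →+* Matrix (Fin 2) (Fin 2) (QuadraticAlgebra R c 0) where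
  toFun x := !![⟨x.re, x.imI⟩, ⟨d * x.imJ, d * x.imK⟩; ⟨x.imJ, -x.imK⟩, ⟨x.re, -x.imI⟩]
  map_one' := by
    ext i j <;> fin_cases i <;> fin_cases j <;>
      simp [QuadraticAlgebra.re_one, QuadraticAlgebra.im_one]
  map_zero' := by ext i j <;> fin_cases i <;> fin_cases j <;> simp
  map_add' x y := by
    ext i j <;> fin_cases i <;> fin_cases j <;> simp <;> ring
  map_mul' x y := by
    ext i j <;> fin_cases i <;> fin_cases j <;> simp [Matrix.mul_apply, Fin.sum_univ_two] <;> ring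

theorem splitHom_apply (x : ℍ[R, c, d]) : splitHom x =
    !![⟨x.re, x.imI⟩, ⟨d * x.imJ, d * x.imK⟩; ⟨x.imJ, -x.imK⟩, ⟨x.re, -x.imI⟩] := rfl

theorem det_splitHom (x : ℍ[R, c, d]) :
    (splitHom x).det = algebraMap R (QuadraticAlgebra R c 0) (qnorm x) := by
  rw [QuadraticAlgebra.algebraMap_eq]
  ext <;> simp [splitHom_apply, Matrix.det_fin_two, qnorm] <;> ring

variable {ι κ : Type*} [Fintype ι] [DecidableEq ι] [Fintype κ] [DecidableEq κ]

/-- The splitting of `M_n((c, d)_R)` over `R[√c]`. -/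
def splitMatrix : Matrix ι ι ℍ[R, c, d] →+*
    Matrix (ι × Fin 2) (ι × Fin 2) (QuadraticAlgebra R c 0) :=
  (Matrix.compRingEquiv ι (Fin 2) (QuadraticAlgebra R c 0)).toRingHom.comp
    (RingHom.mapMatrix splitHom)

theorem splitMatrix_apply (g : Matrix ι ι ℍ[R, c, d]) (i j : ι × Fin 2) :
    splitMatrix g i j = splitHom (g i.1 j.1) i.2 j.2 := rfl

/-- The reduced norm of `M_n((c, d)_R)`, with values in `R`. -/
def nrd (g : Matrix ι ι ℍ[R, c, d]) : R := (splitMatrix g).det.re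

/-- The norm is defined over every commutative ring so that, for a matrix over `K[[t]]`, it can be
compared with the norms over `K((t))` and over the residue field `K`. -/
theorem nrd_map (f : R →+* S) {c' d' : S} (hc : f c = c') (hd : f d = d')
    (g : Matrix ι ι ℍ[R, c, d]) : nrd (g.map (qmap f hc hd)) = f (nrd g) := by
  subst hc hd
  let h : QuadraticAlgebra R c 0 →+* QuadraticAlgebra S (f c) 0 :=
    quadLift ((algebraMap S _).comp f) (quadRoot (f c)) quadRoot_mul_self
  have hh : ∀ z, h z = ⟨f z.re, f z.im⟩ := by
    intro z
    ext <;> simp [h, quadLift, quadRoot]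
  have : splitMatrix (g.map (qmap f rfl rfl)) = h.mapMatrix (splitMatrix g) := by
    ext ⟨i, a⟩ ⟨j, b⟩ <;> fin_cases a <;> fin_cases b <;>
      simp [splitMatrix_apply, splitHom_apply, hh]
  rw [nrd, nrd, this, ← RingHom.map_det, hh]

theorem nrd_submatrix_equiv (e : κ ≃ ι) (g : Matrix ι ι ℍ[R, c, d]) :
    nrd (g.submatrix e e) = nrd g := by
  rw [nrd, nrd, ← Matrix.det_submatrix_equiv_self (e.prodCongr (Equiv.refl (Fin 2)))]
  rfl

theorem det_splitMatrix_diagonal (x : ι → ℍ[R, c, d]) :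
    (splitMatrix (Matrix.diagonal x)).det = algebraMap R _ (∏ i, qnorm (x i)) := by
  have : splitMatrix (Matrix.diagonal x) =
      (Matrix.blockDiagonal fun i => splitHom (x i)).submatrix
        (Equiv.prodComm ι (Fin 2)) (Equiv.prodComm ι (Fin 2)) := by
    refine Matrix.ext fun ⟨i, a⟩ ⟨j, b⟩ => ?_
    by_cases hij : i = j
    · subst hij
      simp [splitMatrix_apply]
    · simp [splitMatrix_apply, Matrix.blockDiagonal_apply, hij]
  rw [this, Matrix.det_submatrix_equiv_self, Matrix.det_blockDiagonal, map_prod]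
  simp only [det_splitHom]

theorem nrd_diagonal (x : ι → ℍ[R, c, d]) : nrd (Matrix.diagonal x) = ∏ i, qnorm (x i) := by
  rw [nrd, det_splitMatrix_diagonal, QuadraticAlgebra.algebraMap_re]

theorem nrd_one : nrd (1 : Matrix ι ι ℍ[R, c, d]) = 1 := by
  rw [← Matrix.diagonal_one, nrd_diagonal]; simp

/-- Conjugation by an invertible block matrix. -/
theorem det_eq_of_mul_diagonal {A : Type*} [CommRing A] (P P' : Matrix (Fin 2) (Fin 2) A)
    (hP : P * P' = 1) (M M' : Matrix ι ι (Matrix (Fin 2) (Fin 2) A))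
    (h : ∀ i j, M i j * P = P * M' i j) :
    (Matrix.comp ι ι (Fin 2) (Fin 2) A M).det = (Matrix.comp ι ι (Fin 2) (Fin 2) A M').det := by
  let φ := Matrix.compRingEquiv ι (Fin 2) A
  have h1 : φ (Matrix.diagonal fun _ => P) * φ (Matrix.diagonal fun _ => P') = 1 := by
    rw [← map_mul, Matrix.diagonal_mul_diagonal]
    simp [hP]
  have h2 : φ M * φ (Matrix.diagonal fun _ => P) = φ (Matrix.diagonal fun _ => P) * φ M' := by
    rw [← map_mul, ← map_mul]
    congr 1
    ext i j : 2
    rw [Matrix.mul_diagonal, Matrix.diagonal_mul, h]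
  have h3 := congrArg Matrix.det h1
  have h4 := congrArg Matrix.det h2
  rw [Matrix.det_mul, Matrix.det_one] at h3
  rw [Matrix.det_mul, Matrix.det_mul] at h4
  change (φ M).det = (φ M').det
  linear_combination (-(φ M).det + (φ M').det) * h3 + (φ (Matrix.diagonal fun _ => P')).det * h4

end NormDef

section NormField

variable {K : Type*} [Field K] {c d : K} {ι κ : Type*} [Fintype ι] [DecidableEq ι]
  [Fintype κ] [DecidableEq κ]

/-- The automorphism `√c ↦ -√c` changes the splitting only by conjugation with the image of the
generator `j`. So the determinant is fixed by it, and its `√c`-part vanishes because `2 ≠ 0`. -/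
theorem det_splitMatrix (h2 : (2 : K) ≠ 0) (hd : d ≠ 0) (g : Matrix ι ι ℍ[K, c, d]) :
    (splitMatrix g).det = algebraMap K _ (nrd g) := by
  let τ : QuadraticAlgebra K c 0 →+* QuadraticAlgebra K c 0 :=
    quadLift (algebraMap K _) (-quadRoot c) (by rw [neg_mul_neg, quadRoot_mul_self])
  have hτ : ∀ z, τ z = ⟨z.re, -z.im⟩ := by
    intro z
    ext <;> simp [τ, quadLift, quadRoot]
  have h : τ (splitMatrix g).det = (splitMatrix g).det := by
    rw [RingHom.map_det]
    refine det_eq_of_mul_diagonal !![0, algebraMap K _ d; 1, 0] !![0, 1; algebraMap K _ d⁻¹, 0] ?_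
      (fun i j => τ.mapMatrix (splitHom (g i j))) (fun i j => splitHom (g i j)) ?_
    · ext i j <;> fin_cases i <;> fin_cases j <;>
        simp [Matrix.mul_apply, Fin.sum_univ_two, hd,
          QuadraticAlgebra.re_one, QuadraticAlgebra.im_one]
    · intro i j
      ext a b <;> fin_cases a <;> fin_cases b <;>
        simp [Matrix.mul_apply, Fin.sum_univ_two, splitHom_apply, hτ] <;> ring
  rw [hτ] at h
  have him := congrArg QuadraticAlgebra.im h
  simp only at him
  have h0 : 2 * (splitMatrix g).det.im = 0 := by linear_combination -him
  ext
  · simp [nrd]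
  · simpa [h2] using h0

theorem nrd_mul (h2 : (2 : K) ≠ 0) (hd : d ≠ 0) (g g' : Matrix ι ι ℍ[K, c, d]) :
    nrd (g * g') = nrd g * nrd g' := by
  apply QuadraticAlgebra.algebraMap_injective (a := c) (b := 0)
  rw [map_mul, ← det_splitMatrix h2 hd, ← det_splitMatrix h2 hd, ← det_splitMatrix h2 hd, map_mul,
    Matrix.det_mul]

theorem nrd_conjTranspose (g : Matrix ι ι ℍ[K, c, d]) : nrd g.conjTranspose = nrd g := by
  rw [nrd, nrd, ← Matrix.det_transpose (splitMatrix g)]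
  congr 1
  -- The conjugate quaternion goes to the adjugate, and the adjugate of a `2 × 2` matrix is its
  -- transpose conjugated by this alternating matrix.
  refine det_eq_of_mul_diagonal !![0, 1; -1, 0] !![0, -1; 1, 0] ?_
      (fun i j => splitHom (star (g j i))) (fun i j => (splitHom (g j i)).transpose) ?_
  · ext i j <;> fin_cases i <;> fin_cases j <;> simp [Matrix.mul_apply, Fin.sum_univ_two]
  · intro i j
    ext a b <;> fin_cases a <;> fin_cases b <;>
        simp [Matrix.mul_apply, Fin.sum_univ_two, splitHom_apply]

theorem nrd_fromBlocks_zero₁₂ (h2 : (2 : K) ≠ 0) (hd : d ≠ 0) (A : Matrix ι ι ℍ[K, c, d])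
    (C : Matrix κ ι ℍ[K, c, d]) (D : Matrix κ κ ℍ[K, c, d]) :
    nrd (Matrix.fromBlocks A 0 C D) = nrd A * nrd D := by
  apply QuadraticAlgebra.algebraMap_injective (a := c) (b := 0)
  rw [map_mul, ← det_splitMatrix h2 hd, ← det_splitMatrix h2 hd, ← det_splitMatrix h2 hd,
    ← Matrix.det_fromBlocks_zero₁₂ _ (.of fun i j => splitHom (C i.1 j.1) i.2 j.2),
    ← Matrix.det_submatrix_equiv_self (Equiv.sumProdDistrib ι κ (Fin 2)) (Matrix.fromBlocks _ _ _ _)]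
  congr 1
  refine Matrix.ext ?_
  rintro ⟨i | i, a⟩ ⟨j | j, b⟩ <;> simp [splitMatrix_apply]

theorem nrd_unique [Unique ι] (g : Matrix ι ι ℍ[K, c, d]) : nrd g = qnorm (g default default) := by
  have : g = Matrix.diagonal fun i => g i i := by
    refine Matrix.ext fun i j => ?_
    rw [Subsingleton.elim i default, Subsingleton.elim j default, Matrix.diagonal_apply_eq]
  rw [this, nrd_diagonal]
  simp

theorem nrd_succ (h2 : (2 : K) ≠ 0) (hd : d ≠ 0) {n : ℕ}
    (g : Matrix (Fin (n + 1)) (Fin (n + 1)) ℍ[K, c, d])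
    (hg : ∀ i : Fin n, g i.castSucc (Fin.last n) = 0) :
    nrd g = nrd (g.submatrix Fin.castSucc Fin.castSucc) * qnorm (g (Fin.last n) (Fin.last n)) := by
  have : g.submatrix (finSumFinEquiv (m := n) (n := 1)) (finSumFinEquiv (m := n) (n := 1)) =
      Matrix.fromBlocks (g.submatrix Fin.castSucc Fin.castSucc) 0
        (g.submatrix (fun _ : Fin 1 => Fin.last n) Fin.castSucc)
        (g.submatrix (fun _ => Fin.last n) (fun _ => Fin.last n)) := by
    have hl : ∀ i : Fin 1, Fin.natAdd n i = Fin.last n := by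
      intro i; ext; simp
    refine Matrix.ext ?_
    rintro (i | i) (j | j)
    · rfl
    · simp only [Matrix.submatrix_apply, finSumFinEquiv_apply_right, hl]
      exact hg i
    · simp [hl]; rfl
    · simp [hl]
  rw [← nrd_submatrix_equiv (finSumFinEquiv (m := n) (n := 1)) g, this,
    nrd_fromBlocks_zero₁₂ h2 hd, nrd_unique (ι := Fin 1)]
  rfl

end NormField

/-! ### Quaternions commuting or anticommuting with a pure quaternion -/

section

variable {F : Type u} [Field F] {c d : F}

/-- From here on "division algebra" is used only as anisotropy of the norm form, the version that
passes to Laurent series. -/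
theorem eq_zero_of_qnorm_eq_zero (hQ : ∀ x : ℍ[F, c, d], x ≠ 0 → IsUnit x) (x : ℍ[F, c, d])
    (hx : qnorm x = 0) : x = 0 := by
  by_contra h
  have h1 := star_mul_self_eq x
  rw [hx, map_zero] at h1
  exact h (star_eq_zero.1 ((hQ x h).mul_left_eq_zero.1 h1))

theorem ne_zero_of_anisotropic (hQ : ∀ x : ℍ[F, c, d], qnorm x = 0 → x = 0) :
    c ≠ 0 ∧ d ≠ 0 := by
  constructor
  · rintro rfl
    have := hQ ⟨0, 1, 0, 0⟩ (by simp [qnorm])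
    simpa using congrArg QuaternionAlgebra.imI this
  · rintro rfl
    have := hQ ⟨0, 0, 1, 0⟩ (by simp [qnorm])
    simpa using congrArg QuaternionAlgebra.imJ this

theorem mul_eq_zero_of_anisotropic (hQ : ∀ x : ℍ[F, c, d], qnorm x = 0 → x = 0)
    {x y : ℍ[F, c, d]} (h : x * y = 0) : x = 0 ∨ y = 0 := by
  have := congrArg qnorm h
  rw [qnorm_mul, qnorm_zero] at this
  exact (mul_eq_zero.1 this).imp (hQ x) (hQ y)

theorem mul_left_cancel_of_anisotropic (hQ : ∀ x : ℍ[F, c, d], qnorm x = 0 → x = 0)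
    {x y z : ℍ[F, c, d]} (hx : x ≠ 0) (h : x * y = x * z) : y = z :=
  sub_eq_zero.1 ((mul_eq_zero_of_anisotropic hQ (x := x) (by rw [mul_sub, h, sub_self])).resolve_left
    hx)

theorem mul_right_cancel_of_anisotropic (hQ : ∀ x : ℍ[F, c, d], qnorm x = 0 → x = 0)
    {x y z : ℍ[F, c, d]} (hx : x ≠ 0) (h : y * x = z * x) : y = z :=
  sub_eq_zero.1 ((mul_eq_zero_of_anisotropic hQ (y := x) (by rw [sub_mul, h, sub_self])).resolve_right
    hx)

theorem inv_smul_star_mul (x : ℍ[F, c, d]) (hx : qnorm x ≠ 0) :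
    ((qnorm x)⁻¹ • star x) * x = 1 := by
  rw [smul_mul_assoc, star_mul_self_eq, Algebra.smul_def, ← map_mul, inv_mul_cancel₀ hx, map_one]

theorem mul_inv_smul_star (x : ℍ[F, c, d]) (hx : qnorm x ≠ 0) :
    x * ((qnorm x)⁻¹ • star x) = 1 := by
  rw [mul_smul_comm, self_mul_star_eq, Algebra.smul_def, ← map_mul, inv_mul_cancel₀ hx, map_one]

theorem smul_pure_eq {q : ℍ[F, c, d]} (hq0 : q ≠ 0) (hq : q.re = 0) {x y : F}
    (h : algebraMap F ℍ[F, c, d] x + y • q = 0) : x = 0 ∧ y = 0 := by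
  have hx : x = 0 := by
    simpa [QuaternionAlgebra.algebraMap_eq, hq] using congrArg QuaternionAlgebra.re h
  refine ⟨hx, ?_⟩
  rw [hx, map_zero, zero_add] at h
  exact (smul_eq_zero.1 h).resolve_right hq0

variable {q : ℍ[F, c, d]} {a : Fˣ}

theorem pure_ne_zero (hq2 : q * q = algebraMap F _ (a : F)) : q ≠ 0 := by
  rintro rfl
  rw [mul_zero, ← map_zero (algebraMap F ℍ[F, c, d])] at hq2
  exact a.ne_zero (QuaternionAlgebra.algebraMap_injective hq2).symm

theorem qnorm_pure (hq : q.re = 0) (hq2 : q * q = algebraMap F _ (a : F)) : qnorm q = -(a : F) := by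
  rw [mul_self_of_re_eq_zero hq, ← map_neg] at hq2
  rw [← QuaternionAlgebra.algebraMap_injective hq2, neg_neg]

theorem qnorm_add_smul_pure (hq : q.re = 0) (hq2 : q * q = algebraMap F _ (a : F)) (x y : F) :
    qnorm (algebraMap F _ x + y • q) = x ^ 2 - a * y ^ 2 := by
  have h := qnorm_pure hq hq2
  simp only [qnorm, hq] at h
  simp [qnorm, QuaternionAlgebra.algebraMap_eq, hq]
  linear_combination y ^ 2 * h

/-- The pure part `p` of `u` also commutes with `q`, so `p * q` is fixed by conjugation and is a
scalar `r`. Multiplying by `q` gives `a p = r q`. -/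
theorem exists_eq_add_smul_of_commute (h2 : (2 : F) ≠ 0) (hq : q.re = 0)
    (hq2 : q * q = algebraMap F _ (a : F)) {u : ℍ[F, c, d]} (hu : u * q = q * u) :
    ∃ x y : F, u = algebraMap F _ x + y • q := by
  set p : ℍ[F, c, d] := ⟨0, u.imI, u.imJ, u.imK⟩ with hp
  have hup : u = algebraMap F _ u.re + p := by
    ext <;> simp [hp, QuaternionAlgebra.algebraMap_eq]
  have hpq : p * q = q * p := by
    rw [hup, add_mul, mul_add, Algebra.commutes] at hu
    exact add_left_cancel hu
  have hs : star (p * q) = p * q := by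
    rw [star_mul, star_eq_neg_of_re_eq_zero hq, star_eq_neg_of_re_eq_zero (x := p) rfl, neg_mul_neg,
      hpq]
  have hz : ∀ z : F, -z = z → z = 0 := by
    intro z hz
    have : 2 * z = 0 := by linear_combination -hz
    exact (mul_eq_zero.1 this).resolve_left h2
  have hr : p * q = algebraMap F _ (p * q).re := by
    ext
    · rfl
    · exact hz _ (congrArg QuaternionAlgebra.imI hs)
    · exact hz _ (congrArg QuaternionAlgebra.imJ hs)
    · exact hz _ (congrArg QuaternionAlgebra.imK hs)
  refine ⟨u.re, (a : F)⁻¹ * (p * q).re, ?_⟩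
  rw [mul_smul, Algebra.smul_def (p * q).re q, ← hr, mul_assoc, hq2, ← Algebra.commutes,
    ← Algebra.smul_def, smul_smul, inv_mul_cancel₀ a.ne_zero, one_smul]
  exact hup

/-- If the trace of `u` were nonzero, the quadratic equation of `u` together with `u² = m` would
make `u` a scalar. It would then commute with `q` as well as anticommute. -/
theorem re_eq_zero_of_anticommute (h2 : (2 : F) ≠ 0) (hQ : ∀ x : ℍ[F, c, d], qnorm x = 0 → x = 0)
    (hq0 : q ≠ 0) {u : ℍ[F, c, d]} {m : F} (hu : u * q = -(q * u)) (hm : u * u = algebraMap F _ m) :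
    u.re = 0 := by
  by_contra h
  have h1 : (2 * u.re) • u = algebraMap F _ (m + qnorm u) := by
    rw [map_add, ← hm, ← star_mul_self_eq, ← add_mul, Algebra.smul_def]
    congr 1
    ext <;> simp [QuaternionAlgebra.algebraMap_eq] ; ring
  have h3 : u = algebraMap F _ ((2 * u.re)⁻¹ * (m + qnorm u)) := by
    rw [map_mul, ← h1, ← Algebra.smul_def, smul_smul, inv_mul_cancel₀ (mul_ne_zero h2 h), one_smul]
  have h4 : u * q = q * u := by rw [h3, Algebra.commutes]
  rw [h4] at hu
  have h5 : (2 : F) • (q * u) = 0 := by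
    rw [two_smul]; nth_rw 1 [hu]; exact neg_add_cancel _
  rcases mul_eq_zero_of_anisotropic hQ ((smul_eq_zero.1 h5).resolve_left h2) with h6 | h6
  · exact hq0 h6
  · exact h (by rw [h6]; rfl)

theorem qnorm_of_anticommute (h2 : (2 : F) ≠ 0) (hQ : ∀ x : ℍ[F, c, d], qnorm x = 0 → x = 0)
    (hq0 : q ≠ 0) {u : ℍ[F, c, d]} {m : F} (hu : u * q = -(q * u)) (hm : u * u = algebraMap F _ m) :
    qnorm u = -m := by
  have h := mul_self_of_re_eq_zero (re_eq_zero_of_anticommute h2 hQ hq0 hu hm)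
  rw [hm, ← map_neg] at h
  rw [QuaternionAlgebra.algebraMap_injective h, neg_neg]

/-! ### The sets `G₊(a)` and `G₋(a)` in terms of elements of `Q` -/

/-- `(a, m)` acts on the plane `F[√a]`: `i` is multiplication by `√a`, and `j` is conjugation
followed by multiplication by `x + y√a`, whose square is the norm `m`. The matrices below are taken
in the basis `1, √a`. -/
theorem split_of_norm (h2 : (2 : F) ≠ 0) {a m x y : F} (ha : a ≠ 0) (hm : m ≠ 0)
    (h : x ^ 2 - a * y ^ 2 = m) : Nonempty (ℍ[F, a, m] ≃ₐ[F] Matrix (Fin 2) (Fin 2) F) := by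
  let B : QuaternionAlgebra.Basis (Matrix (Fin 2) (Fin 2) F) a 0 m :=
    { i := !![0, a; 1, 0]
      j := !![x, -(a * y); y, -x]
      k := !![0, a; 1, 0] * !![x, -(a * y); y, -x]
      i_mul_i := by
        ext i j; fin_cases i <;> fin_cases j <;> simp [Matrix.mul_apply, Fin.sum_univ_two]
      j_mul_j := by
        ext i j; fin_cases i <;> fin_cases j <;>
          simp [Matrix.mul_apply, Fin.sum_univ_two] <;> first | linear_combination h | ring
      i_mul_j := rfl
      j_mul_i := by
        ext i j; fin_cases i <;> fin_cases j <;>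
          simp [Matrix.mul_apply, Fin.sum_univ_two] <;> ring }
  have hinj : Function.Injective B.liftHom := by
    rw [injective_iff_map_eq_zero]
    intro z hz
    have hz' : B.lift z = 0 := hz
    have h00 := congrFun (congrFun hz' 0) 0
    have h01 := congrFun (congrFun hz' 0) 1
    have h10 := congrFun (congrFun hz' 1) 0
    have h11 := congrFun (congrFun hz' 1) 1
    simp [QuaternionAlgebra.Basis.lift, B, Matrix.algebraMap_matrix_apply] at h00 h01 h10 h11
    have e0 : z.re = 0 := (mul_eq_zero.1
      (show 2 * z.re = 0 by linear_combination h00 + h11)).resolve_left h2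
    have e1 : z.imI = 0 := (mul_eq_zero.1
      (show 2 * a * z.imI = 0 by linear_combination h01 + a * h10)).resolve_left (mul_ne_zero h2 ha)
    have e2 : z.imJ = 0 := (mul_eq_zero.1
      (show m * z.imJ = 0 by linear_combination x * h00 - a * y * h10 - x * e0 + a * y * e1 - z.imJ * h)).resolve_left hm
    have e3 : z.imK = 0 := (mul_eq_zero.1
      (show m * z.imK = 0 by linear_combination x * h10 - y * h00 + y * e0 - x * e1 - z.imK * h)).resolve_left hm
    ext <;> assumption
  refine ⟨AlgEquiv.ofBijective B.liftHom ⟨hinj, ?_⟩⟩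
  refine (LinearMap.injective_iff_surjective_of_finrank_eq_finrank (f := B.liftHom.toLinearMap)
    ?_).1 hinj
  rw [QuaternionAlgebra.finrank_eq_four, Module.finrank_matrix]
  simp

/-- A split algebra has a nonzero element of norm `0`. Writing the norm of `(a, m)` as `N(v) - m
N(w)`, with `v` and `w` transported to `F(q) ⊆ Q`, this exhibits `m` as the norm of `v / w`. -/
theorem mem_G_one_iff (h2 : (2 : F) ≠ 0) (hQ : ∀ x : ℍ[F, c, d], qnorm x = 0 → x = 0)
    (hq : q.re = 0) (hq2 : q * q = algebraMap F _ (a : F)) (m : Fˣ) :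
    m ∈ G c d 1 a ↔ ∃ u : ℍ[F, c, d], u * q = q * u ∧ qnorm u = m := by
  simp only [G, if_true, Set.mem_ofPred_eq]
  constructor
  · rintro ⟨e⟩
    -- A nonzero nilpotent matrix, whose preimage has norm zero.
    set z := e.symm !![0, 1; 0, 0] with hz
    have hz0 : z ≠ 0 := by
      rw [hz, Ne, map_eq_zero_iff _ e.symm.injective]
      intro h
      simpa using congrFun (congrFun h 0) 1
    have hzz : qnorm z = 0 := by
      have : z * z = 0 := by
        rw [hz, ← map_mul]
        convert map_zero e.symm
        ext i j; fin_cases i <;> fin_cases j <;> simp [Matrix.mul_apply, Fin.sum_univ_two]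
      have := congrArg qnorm this
      rw [qnorm_mul, qnorm_zero] at this
      exact mul_self_eq_zero.1 this
    have hv := qnorm_add_smul_pure hq hq2 z.re z.imI
    have hw := qnorm_add_smul_pure hq hq2 z.imJ z.imK
    set v := algebraMap F ℍ[F, c, d] z.re + z.imI • q
    set w := algebraMap F ℍ[F, c, d] z.imJ + z.imK • q with hwd
    have hvw : qnorm v = m * qnorm w := by
      rw [hv, hw]
      simp only [qnorm] at hzz
      linear_combination hzz
    have hw0 : qnorm w ≠ 0 := by
      intro h
      rw [h, mul_zero] at hvw
      obtain ⟨h3, h4⟩ := smul_pure_eq (pure_ne_zero hq2) hq (hQ _ hvw)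
      obtain ⟨h5, h6⟩ := smul_pure_eq (pure_ne_zero hq2) hq (hQ _ h)
      exact hz0 (by ext <;> assumption)
    have hc : ∀ x y : F, Commute (algebraMap F ℍ[F, c, d] x + y • q) q := fun x y =>
      (Algebra.commute_algebraMap_left x q).add_left ((Commute.refl q).smul_left y)
    have hsw : star w = algebraMap F ℍ[F, c, d] z.imJ + (-z.imK) • q := by
      ext <;> simp [hwd, QuaternionAlgebra.algebraMap_eq, hq]
    refine ⟨(qnorm w)⁻¹ • (v * star w), ?_, ?_⟩
    · rw [hsw]
      exact ((hc _ _).mul_left (hc _ _)).smul_left _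
    · rw [qnorm_smul, qnorm_mul, qnorm_star, hvw]
      field_simp
  · rintro ⟨u, hu, hm⟩
    obtain ⟨x, y, rfl⟩ := exists_eq_add_smul_of_commute h2 hq hq2 hu
    exact split_of_norm h2 a.ne_zero m.ne_zero ((qnorm_add_smul_pure hq hq2 x y).symm.trans hm)

theorem mem_G_neg_one_iff (h2 : (2 : F) ≠ 0) (hQ : ∀ x : ℍ[F, c, d], qnorm x = 0 → x = 0)
    (hq : q.re = 0) (hq2 : q * q = algebraMap F _ (a : F)) (m : Fˣ) :
    m ∈ G c d (-1) a ↔ ∃ u : ℍ[F, c, d], u * q = -(q * u) ∧ u * u = algebraMap F _ (m : F) := by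
  have h1 : (-1 : ℤˣ) ≠ 1 := by decide
  have hq0 := pure_ne_zero hq2
  simp only [G, if_neg h1, Set.mem_ofPred_eq]
  constructor
  · rintro ⟨e⟩
    set I := e ⟨0, 1, 0, 0⟩ with hI
    set J := e ⟨0, 0, 1, 0⟩ with hJ
    have hII : I * I = algebraMap F _ (a : F) := by
      rw [hI, ← map_mul, ← e.commutes (a : F)]
      congr 1
      ext <;> simp [QuaternionAlgebra.algebraMap_eq]
    have hJJ : J * J = algebraMap F _ (m : F) := by
      rw [hJ, ← map_mul, ← e.commutes (m : F)]
      congr 1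
      ext <;> simp [QuaternionAlgebra.algebraMap_eq]
    have hJI : J * I = -(I * J) := by
      rw [hI, hJ, ← map_mul, ← map_mul, ← map_neg]
      congr 1
      ext <;> simp
    by_cases hqI : q + I = 0
    · have : q = -I := eq_neg_of_add_eq_zero_left hqI
      exact ⟨J, by rw [this, mul_neg, neg_mul, hJI], hJJ⟩
    -- `q` and `I` have the same square, so `q (q + I) = (q + I) I`: conjugation by `p` takes `I` to
    -- `q`, and takes `J` to the required element. The excluded case is `I = -q`, where `J` itself
    -- serves.
    · set p := q + I with hp
      have hp0 : qnorm p ≠ 0 := fun h => hqI (hQ _ h)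
      have hqp : q * p = p * I := by
        rw [hp, mul_add, add_mul, hq2, hII, add_comm]
      set p' := (qnorm p)⁻¹ • star p with hp'
      have h3 : p' * p = 1 := inv_smul_star_mul p hp0
      have h4 : p * p' = 1 := mul_inv_smul_star p hp0
      have h5 : p' * q = I * p' := by
        calc p' * q = p' * (q * p) * p' := by rw [mul_assoc, mul_assoc, h4, mul_one]
          _ = I * p' := by rw [hqp, ← mul_assoc, h3, one_mul]
      refine ⟨p * J * p', ?_, ?_⟩
      · calc p * J * p' * q = p * (J * I) * p' := by rw [mul_assoc, h5]; noncomm_ring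
          _ = -(p * I * J * p') := by rw [hJI]; noncomm_ring
          _ = _ := by rw [← hqp]; noncomm_ring
      · calc p * J * p' * (p * J * p') = p * J * (p' * p) * J * p' := by noncomm_ring
          _ = p * (J * J) * p' := by rw [h3]; noncomm_ring
          _ = _ := by rw [hJJ, ← Algebra.commutes, mul_assoc, h4, mul_one]
  · rintro ⟨u, hu, hm⟩
    let B : QuaternionAlgebra.Basis ℍ[F, c, d] (a : F) 0 (m : F) :=
      { i := q
        j := u
        k := q * u
        i_mul_i := by rw [hq2, Algebra.algebraMap_eq_smul_one, zero_smul, add_zero]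
        j_mul_j := by rw [hm, Algebra.algebraMap_eq_smul_one]
        i_mul_j := rfl
        j_mul_i := by rw [hu, zero_smul, zero_sub] }
    have hinj : Function.Injective B.liftHom := by
      rw [injective_iff_map_eq_zero]
      intro z hz
      have hz' : (algebraMap F _ z.re + z.imI • q) + (algebraMap F _ z.imJ + z.imK • q) * u = 0 := by
        rw [← hz]
        change _ = algebraMap F _ z.re + z.imI • q + z.imJ • u + z.imK • (q * u)
        rw [add_mul, smul_mul_assoc, ← Algebra.smul_def]; abel
      set v := algebraMap F ℍ[F, c, d] z.re + z.imI • q with hv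
      set w := algebraMap F ℍ[F, c, d] z.imJ + z.imK • q with hw
      have hc : ∀ x y : F, Commute (algebraMap F ℍ[F, c, d] x + y • q) q := fun x y =>
        (Algebra.commute_algebraMap_left x q).add_left ((Commute.refl q).smul_left y)
      have hwu : w * u = -v := eq_neg_of_add_eq_zero_right hz'
      -- Otherwise `u = -w⁻¹ v` would lie in `F(q)` and commute with `q`.
      have hw0 : w = 0 := by
        by_contra hw0
        have h3 : w * (u * q) = w * (q * u) := by
          rw [← mul_assoc, hwu, ← mul_assoc, (hc _ _).eq, mul_assoc, hwu, neg_mul, (hc _ _).eq,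
            mul_neg]
        have h4 := mul_left_cancel_of_anisotropic hQ hw0 h3
        rw [h4] at hu
        have h5 : (2 : F) • (q * u) = 0 := by
          rw [two_smul]; nth_rw 1 [hu]; exact neg_add_cancel _
        rcases mul_eq_zero_of_anisotropic hQ ((smul_eq_zero.1 h5).resolve_left h2) with h6 | h6
        · exact hq0 h6
        · rw [h6, mul_zero, ← map_zero (algebraMap F ℍ[F, c, d])] at hm
          exact m.ne_zero (QuaternionAlgebra.algebraMap_injective hm).symm
      have hv0 : v = 0 := by rw [hw0, zero_mul] at hwu; exact neg_eq_zero.1 hwu.symm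
      obtain ⟨h3, h4⟩ := smul_pure_eq hq0 hq hv0
      obtain ⟨h5, h6⟩ := smul_pure_eq hq0 hq hw0
      ext <;> assumption
    refine ⟨AlgEquiv.ofBijective B.liftHom ⟨hinj, ?_⟩⟩
    refine (LinearMap.injective_iff_surjective_of_finrank_eq_finrank (f := B.liftHom.toLinearMap)
      ?_).1 hinj
    rw [QuaternionAlgebra.finrank_eq_four, QuaternionAlgebra.finrank_eq_four]

/-- A similitude of the form `⟨q⟩` with multiplier `m` and its sign. -/
theorem similitude_sign (hQ : ∀ x : ℍ[F, c, d], qnorm x = 0 → x = 0)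
    (hq0 : q ≠ 0) {u : ℍ[F, c, d]} {m : F} (h : star u * q * u = m • q) :
    ∃ ε : ℤˣ, qnorm u = (ε : ℤ) * m := by
  have h1 := congrArg qnorm h
  rw [qnorm_mul, qnorm_mul, qnorm_star, qnorm_smul] at h1
  have h3 : qnorm q ≠ 0 := fun h => hq0 (hQ _ h)
  have h4 : qnorm u ^ 2 = m ^ 2 := mul_right_cancel₀ h3 (by linear_combination h1)
  rcases sq_eq_sq_iff_eq_or_eq_neg.1 h4 with h5 | h5
  · exact ⟨1, by simpa using h5⟩
  · exact ⟨-1, by simpa using h5⟩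

/-- Multiplying `ū q u = m q` by `u` on the left gives `Nrd(u) q u = m u q`. The sign of `u` thus
tells whether it commutes or anticommutes with `q`. -/
theorem similitude_commute {u : ℍ[F, c, d]} {m : F} (hm : m ≠ 0)
    (h : star u * q * u = m • q) {ε : ℤˣ}
    (hε : qnorm u = (ε : ℤ) * m) : u * q = (ε : ℤ) • (q * u) := by
  have h1 : u * (star u * q * u) = u * (m • q) := by rw [h]
  rw [← mul_assoc, ← mul_assoc, self_mul_star_eq, mul_smul_comm, hε, mul_assoc, ← Algebra.smul_def,
    mul_comm, mul_smul] at h1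
  have h3 := smul_right_injective _ hm h1
  rw [← h3, Int.cast_smul_eq_zsmul]

theorem mem_G_of_similitude (h2 : (2 : F) ≠ 0) (hQ : ∀ x : ℍ[F, c, d], qnorm x = 0 → x = 0)
    (hq : q.re = 0) (hq2 : q * q = algebraMap F _ (a : F)) {m : Fˣ}
    {u : ℍ[F, c, d]} (h : star u * q * u = (m : F) • q) {ε : ℤˣ}
    (hε : qnorm u = (ε : ℤ) * (m : F)) :
    m ∈ G c d ε a ∧ (ε = -1 → u * u = algebraMap F _ (m : F)) := by
  have h1 := similitude_commute m.ne_zero h hε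
  rcases Int.units_eq_one_or ε with rfl | rfl
  · refine ⟨(mem_G_one_iff h2 hQ hq hq2 m).2 ⟨u, by simpa using h1, by simpa using hε⟩, ?_⟩
    intro h
    exact absurd h (by decide)
  · simp only [Units.val_neg, Units.val_one, neg_smul, one_smul] at h1
    have hu : u * u = algebraMap F _ (m : F) := by
      have hsu : star u = -u := by
        have h3 := congrArg star h1
        rw [star_mul, star_neg, star_mul, star_eq_neg_of_re_eq_zero hq] at h3
        have h4 : q * (star u * q * u) = (m : F) • (q * q) := by rw [h, mul_smul_comm]
        have h5 : q * star u = -(star u * q) := by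
          rw [neg_mul, mul_neg, neg_neg] at h3
          rw [← h3, neg_neg]
        have hm0 : qnorm u ≠ 0 := by rw [hε]; simp
        have hu0 : u ≠ 0 := by rintro rfl; simp at hm0
        -- Both `u` and its conjugate anticommute with `q`, hence so does the trace of `u`, which is
        -- a scalar and must vanish.
        have h6 : (u + star u) * q = -(q * (u + star u)) := by
          rw [add_mul, mul_add, h1, h5]; abel
        have h7 : u + star u = algebraMap F _ (2 * u.re) := by
          ext <;> simp [QuaternionAlgebra.algebraMap_eq]; ring
        rw [h7, ← Algebra.commutes, ← Algebra.smul_def] at h6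
        have h8 : (2 * (2 * u.re)) • q = 0 := by
          rw [two_mul, add_smul]; nth_rw 1 [h6]; exact neg_add_cancel _
        have h9 := (smul_eq_zero.1 h8).resolve_right (pure_ne_zero hq2)
        have h10 : 2 * u.re = 0 := (mul_eq_zero.1 h9).resolve_left h2
        rw [h10, map_zero] at h7
        exact eq_neg_of_add_eq_zero_right h7
      have := star_mul_self_eq u
      rw [hsu, hε, neg_mul] at this
      rw [← neg_neg (u * u), this, ← map_neg]
      simp
    exact ⟨(mem_G_neg_one_iff h2 hQ hq hq2 m).2 ⟨u, h1, hu⟩, fun _ => hu⟩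

theorem exists_similitude_of_mem_G (h2 : (2 : F) ≠ 0) (hQ : ∀ x : ℍ[F, c, d], qnorm x = 0 → x = 0)
    (hq : q.re = 0) (hq2 : q * q = algebraMap F _ (a : F)) {m : Fˣ} {ε : ℤˣ} (h : m ∈ G c d ε a) :
    ∃ u : ℍ[F, c, d], star u * q * u = (m : F) • q ∧ qnorm u = (ε : ℤ) * (m : F) ∧
      (ε = -1 → u * u = algebraMap F _ (m : F)) := by
  rcases Int.units_eq_one_or ε with rfl | rfl
  · obtain ⟨u, hu, hm⟩ := (mem_G_one_iff h2 hQ hq hq2 m).1 h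
    refine ⟨u, ?_, by simpa using hm, fun h => absurd h (by decide)⟩
    rw [mul_assoc, ← hu, ← mul_assoc, star_mul_self_eq, hm, Algebra.smul_def]
  · obtain ⟨u, hu, hm⟩ := (mem_G_neg_one_iff h2 hQ hq hq2 m).1 h
    have hn := qnorm_of_anticommute h2 hQ (pure_ne_zero hq2) hu hm
    refine ⟨u, ?_, by simpa using hn, fun _ => hm⟩
    have h3 : q * u = -(u * q) := by rw [hu, neg_neg]
    rw [mul_assoc, h3, mul_neg, ← mul_assoc, star_mul_self_eq, hn, map_neg, neg_mul, neg_neg,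
      Algebra.smul_def]

end

/-! ### The reduced norm of a hermitian matrix is a square -/

section

variable {K : Type*} [Field K] {c d : K}

theorem eq_algebraMap_of_star_eq (h2 : (2 : K) ≠ 0) {x : ℍ[K, c, d]} (h : star x = x) :
    x = algebraMap K _ x.re := by
  have hz : ∀ z : K, -z = z → z = 0 := by
    intro z hz
    have : 2 * z = 0 := by linear_combination -hz
    exact (mul_eq_zero.1 this).resolve_left h2
  ext
  · rfl
  · exact hz _ (congrArg QuaternionAlgebra.imI h)
  · exact hz _ (congrArg QuaternionAlgebra.imJ h)
  · exact hz _ (congrArg QuaternionAlgebra.imK h)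

/-- Gaussian elimination with the last diagonal entry as pivot. The pivot is hermitian, hence a
scalar `α`, of norm `α²`, and the Schur complement is again hermitian. -/
theorem nrd_hermitian_of_last (h2 : (2 : K) ≠ 0) (hd : d ≠ 0) {n : ℕ}
    (ih : ∀ y : Matrix (Fin n) (Fin n) ℍ[K, c, d], y.conjTranspose = y → ∃ z, nrd y = z ^ 2)
    (y : Matrix (Fin (n + 1)) (Fin (n + 1)) ℍ[K, c, d]) (hy : y.conjTranspose = y)
    (hl : y (Fin.last n) (Fin.last n) ≠ 0) : ∃ z, nrd y = z ^ 2 := by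
  have hs : ∀ i j, star (y j i) = y i j := fun i j => congrFun (congrFun hy i) j
  obtain ⟨α, hα⟩ : ∃ α, y (Fin.last n) (Fin.last n) = algebraMap K _ α :=
    ⟨_, eq_algebraMap_of_star_eq h2 (hs _ _)⟩
  have hα0 : α ≠ 0 := by rintro rfl; exact hl (by rw [hα, map_zero])
  -- Multipliers of the last row that clear the last column above the pivot; the entry at the pivot
  -- is `0` so that the row itself is kept.
  set w : Fin (n + 1) → ℍ[K, c, d] :=
    Function.update (fun i => α⁻¹ • y i (Fin.last n)) (Fin.last n) 0 with hw
  have hwc : ∀ i : Fin n, w i.castSucc = α⁻¹ • y i.castSucc (Fin.last n) := fun i =>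
    Function.update_of_ne (Fin.castSucc_lt_last i).ne _ _
  have hwl : w (Fin.last n) = 0 := Function.update_self _ _ _
  set e : Matrix (Fin (n + 1)) (Fin (n + 1)) ℍ[K, c, d] :=
    Matrix.of fun i j => if j = Fin.last n then w i else 0 with he
  have hp : nrd (1 - e) = 1 := by
    rw [← nrd_conjTranspose, nrd_succ h2 hd]
    · have h1 : (1 - e).conjTranspose.submatrix Fin.castSucc Fin.castSucc =
          (1 : Matrix (Fin n) (Fin n) ℍ[K, c, d]) := by
        refine Matrix.ext fun i j => ?_
        by_cases hij : i = j
        · subst hij; simp [he, (Fin.castSucc_lt_last i).ne]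
        · simp [he, (Fin.castSucc_lt_last i).ne, hij]
      rw [h1, nrd_one]
      simp [he, hwl]
    · intro i
      simp [he, (Fin.castSucc_lt_last i).ne, (Fin.castSucc_lt_last i).ne']
  have hm : ∀ i j, ((1 - e) * y) i j = y i j - w i * y (Fin.last n) j := by
    intro i j
    rw [sub_mul, one_mul, Matrix.sub_apply, Matrix.mul_apply]
    simp [he]
  have hy1 : nrd y = nrd ((1 - e) * y) := by rw [nrd_mul h2 hd, hp, one_mul]
  obtain ⟨z, hz⟩ := ih (((1 - e) * y).submatrix Fin.castSucc Fin.castSucc) (by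
    refine Matrix.ext fun i j => ?_
    rw [Matrix.conjTranspose_apply, Matrix.submatrix_apply, Matrix.submatrix_apply, hm, hm, hwc,
      hwc, star_sub, star_mul, QuaternionAlgebra.star_smul', hs, hs, hs, smul_mul_assoc,
      mul_smul_comm])
  refine ⟨z * α, ?_⟩
  rw [hy1, nrd_succ h2 hd, hz, hm, hwl, zero_mul, sub_zero, hα, qnorm_algebraMap, mul_pow]
  intro i
  rw [hm, hwc, hα, ← Algebra.commutes, ← Algebra.smul_def, smul_smul, mul_inv_cancel₀ hα0, one_smul,
    sub_self]

theorem nrd_hermitian_of_diagonal (h2 : (2 : K) ≠ 0) (hd : d ≠ 0) {n : ℕ}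
    (ih : ∀ y : Matrix (Fin n) (Fin n) ℍ[K, c, d], y.conjTranspose = y → ∃ z, nrd y = z ^ 2)
    (y : Matrix (Fin (n + 1)) (Fin (n + 1)) ℍ[K, c, d]) (hy : y.conjTranspose = y)
    (k : Fin (n + 1)) (hl : y k k ≠ 0) : ∃ z, nrd y = z ^ 2 := by
  rw [← nrd_submatrix_equiv (Equiv.swap k (Fin.last n))]
  refine nrd_hermitian_of_last h2 hd ih _ ?_ ?_
  · rw [Matrix.conjTranspose_submatrix, hy]
  · simpa using hl

theorem exists_nrd_hermitian (h2 : (2 : K) ≠ 0) (hQ : ∀ x : ℍ[K, c, d], qnorm x = 0 → x = 0)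
    {n : ℕ} (y : Matrix (Fin n) (Fin n) ℍ[K, c, d]) (hy : y.conjTranspose = y) :
    ∃ z, nrd y = z ^ 2 := by
  have hd := (ne_zero_of_anisotropic hQ).2
  induction n with
  | zero => exact ⟨1, by rw [show y = 1 from Subsingleton.elim _ _, nrd_one, one_pow]⟩
  | succ n ih =>
    by_cases hdiag : ∃ k, y k k ≠ 0
    · obtain ⟨k, hk⟩ := hdiag
      exact nrd_hermitian_of_diagonal h2 hd ih y hy k hk
    push Not at hdiag
    by_cases h0 : y = 0
    · refine ⟨0, ?_⟩
      rw [h0, ← Matrix.diagonal_zero, nrd_diagonal]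
      simp
    obtain ⟨i, j, hij⟩ : ∃ i j, y i j ≠ 0 := by
      by_contra h
      push Not at h
      exact h0 (Matrix.ext h)
    have hne : i ≠ j := by rintro rfl; exact hij (hdiag i)
    have hs : ∀ i j, star (y j i) = y i j := fun i j => congrFun (congrFun hy i) j
    set β := y i j with hβ
    -- When the diagonal is zero, replacing `y` by `p* y p` puts `2 Nrd β ≠ 0` in position `(j, j)`
    -- and changes the norm by the square `(nrd p)²`.
    set p : Matrix (Fin (n + 1)) (Fin (n + 1)) ℍ[K, c, d] := 1 + Matrix.single i j β with hp
    have hp1 : p * (1 - Matrix.single i j β) = 1 := by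
      rw [hp, add_mul, mul_sub, mul_sub, one_mul, one_mul, mul_one,
        Matrix.single_mul_single_of_ne (h := hne.symm)]
      abel
    have hp0 : nrd p ≠ 0 := by
      intro h
      have := congrArg nrd hp1
      rw [nrd_mul h2 hd, h, zero_mul, nrd_one] at this
      exact zero_ne_one this
    obtain ⟨z, hz⟩ := nrd_hermitian_of_diagonal h2 hd ih (p.conjTranspose * y * p) (by
      simp only [Matrix.conjTranspose_mul, Matrix.conjTranspose_conjTranspose, hy, mul_assoc]) j (by
      have h3 : (p.conjTranspose * y * p) j j = (2 : K) • algebraMap K ℍ[K, c, d] (qnorm β) := by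
        rw [hp, Matrix.conjTranspose_add, Matrix.conjTranspose_one, Matrix.conjTranspose_single,
          add_mul, one_mul, mul_add, mul_one, add_mul]
        simp only [Matrix.add_apply]
        rw [Matrix.mul_single_apply_same, Matrix.mul_single_apply_same,
          Matrix.single_mul_apply_same, Matrix.single_mul_apply_same, hdiag, hdiag,
          ← hs j i, ← hβ, star_mul_self_eq, two_smul]
        simp
      rw [h3]
      intro h4
      have h5 := (smul_eq_zero.1 h4).resolve_left h2
      rw [← map_zero (algebraMap K ℍ[K, c, d])] at h5
      exact hij (hQ _ (QuaternionAlgebra.algebraMap_injective h5)))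
    rw [nrd_mul h2 hd, nrd_mul h2 hd, nrd_conjTranspose] at hz
    refine ⟨z / nrd p, ?_⟩
    rw [div_pow, ← hz]
    field_simp

end

/-! ### Diagonal sesquilinear forms and similitudes over quaternion algebras -/

section Form

variable {R S : Type*} [CommRing R] [CommRing S] {c d : R} {n : ℕ}

/-- The sesquilinear form with diagonal coefficients `D`. -/
def hform (D x y : Fin n → ℍ[R, c, d]) : ℍ[R, c, d] := ∑ i, star (x i) * D i * y i

/-- `g` is a similitude of the form with diagonal coefficients `D`, with multiplier `m`. -/
def IsSim (D : Fin n → ℍ[R, c, d]) (g : Matrix (Fin n) (Fin n) ℍ[R, c, d]) (m : R) : Prop :=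
  ∀ j k, hform D (fun i => g i j) (fun i => g i k) = if j = k then m • D j else 0

theorem hform_succ (D x y : Fin (n + 1) → ℍ[R, c, d]) :
    hform D x y = hform (fun i : Fin n => D i.castSucc) (fun i => x i.castSucc)
      (fun i => y i.castSucc) + star (x (Fin.last n)) * D (Fin.last n) * y (Fin.last n) :=
  Fin.sum_univ_castSucc _

theorem hform_smul_smul (D x y : Fin n → ℍ[R, c, d]) (r s : R) :
    hform D (fun i => r • x i) (fun i => s • y i) = (r * s) • hform D x y := by
  simp only [hform, Finset.smul_sum]
  refine Finset.sum_congr rfl fun i _ => ?_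
  rw [QuaternionAlgebra.star_smul', smul_mul_assoc, smul_mul_assoc, mul_smul_comm, smul_smul]

theorem hform_qmap (f : R →+* S) {c' d' : S} (hc : f c = c') (hd : f d = d')
    (D x y : Fin n → ℍ[R, c, d]) :
    hform (fun i => qmap f hc hd (D i)) (fun i => qmap f hc hd (x i))
      (fun i => qmap f hc hd (y i)) = qmap f hc hd (hform D x y) := by
  simp only [hform, map_sum, map_mul, qmap_star]

theorem IsSim.smul {D : Fin n → ℍ[R, c, d]} {g : Matrix (Fin n) (Fin n) ℍ[R, c, d]} {m : R}
    (h : IsSim D g m) (r : R) : IsSim D (r • g) (r ^ 2 * m) := by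
  intro j k
  have := hform_smul_smul D (fun i => g i j) (fun i => g i k) r r
  simp only [Matrix.smul_apply]
  rw [this, h j k]
  split_ifs
  · rw [smul_smul, sq]
  · rw [smul_zero]

end Form

/-! ### Laurent series -/

section Laurent

variable {K : Type*} [Field K]

variable (K) in
/-- The inclusion of power series in Laurent series. -/
noncomputable def psToL : PowerSeries K →+* LaurentSeries K := HahnSeries.ofPowerSeries ℤ K

variable (K) in
/-- The constant coefficient. -/
noncomputable def psRes : PowerSeries K →+* K := PowerSeries.constantCoeff

variable (K) in
/-- The indeterminate. -/
noncomputable def tvar : LaurentSeries K := HahnSeries.single 1 1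

theorem psToL_injective : Function.Injective (psToL K) := HahnSeries.ofPowerSeries_injective

theorem psToL_X : psToL K PowerSeries.X = tvar K := HahnSeries.ofPowerSeries_X

theorem psToL_C (x : K) : psToL K (PowerSeries.C x) = HahnSeries.C x :=
  HahnSeries.ofPowerSeries_C x

theorem psRes_C (x : K) : psRes K (PowerSeries.C x) = x := PowerSeries.constantCoeff_C x

theorem psRes_X : psRes K PowerSeries.X = 0 := PowerSeries.constantCoeff_X

theorem exists_X_mul_of_psRes {x : PowerSeries K} (h : psRes K x = 0) :
    ∃ y, x = PowerSeries.X * y :=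
  PowerSeries.X_dvd_iff.2 h

theorem tvar_ne_zero : tvar K ≠ 0 := HahnSeries.single_ne_zero one_ne_zero

theorem tvar_zpow_natCast (k : ℕ) : tvar K ^ (k : ℤ) = psToL K (PowerSeries.X ^ k) := by
  rw [zpow_natCast, map_pow, psToL_X]

/-- A nonzero finite family of Laurent series is a power of the indeterminate times a family of
power series that do not all vanish at `0`. -/
theorem exists_normalize {κ : Type*} [Finite κ] (x : κ → LaurentSeries K) (hx : ∃ k, x k ≠ 0) :
    ∃ (m : ℤ) (y : κ → PowerSeries K), (∀ k, x k = tvar K ^ m * psToL K (y k)) ∧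
      ∃ k, psRes K (y k) ≠ 0 := by
  classical
  have := Fintype.ofFinite κ
  obtain ⟨k₀, hk₀, hmin⟩ := Finset.exists_min_image (Finset.univ.filter fun k => x k ≠ 0)
    (fun k => (x k).order) (by obtain ⟨k, hk⟩ := hx; exact ⟨k, by simpa using hk⟩)
  simp only [Finset.mem_filter, Finset.mem_univ, true_and] at hk₀ hmin
  have hpart : ∀ z : LaurentSeries K, z = tvar K ^ z.order * psToL K z.powerSeriesPart := by
    intro z
    conv_lhs => rw [← LaurentSeries.single_order_mul_powerSeriesPart z]
    rw [RatFunc.single_zpow]; rfl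
  have hone : ∀ k, ∃ y, x k = tvar K ^ (x k₀).order * psToL K y := by
    intro k
    by_cases hk : x k = 0
    · exact ⟨0, by rw [hk, map_zero, mul_zero]⟩
    · obtain ⟨j, hj⟩ := Int.eq_ofNat_of_zero_le (sub_nonneg.2 (hmin k hk))
      refine ⟨PowerSeries.X ^ j * (x k).powerSeriesPart, ?_⟩
      rw [map_mul, ← tvar_zpow_natCast, ← hj, ← mul_assoc, ← zpow_add₀ tvar_ne_zero,
        add_sub_cancel]
      exact hpart _
  choose y hy using hone
  refine ⟨_, y, hy, k₀, ?_⟩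
  have h1 : y k₀ = (x k₀).powerSeriesPart := by
    apply psToL_injective
    exact mul_left_cancel₀ (zpow_ne_zero _ tvar_ne_zero) ((hy k₀).symm.trans (hpart _))
  rw [h1]
  change PowerSeries.constantCoeff _ ≠ 0
  rw [← PowerSeries.coeff_zero_eq_constantCoeff_apply, LaurentSeries.powerSeriesPart_coeff]
  simpa using HahnSeries.coeff_order_eq_zero.not.2 hk₀

/-- If the exponents differed, one of the two units would be divisible by the indeterminate. -/
theorem zpow_tvar_unique {a b : ℤ} {u v : PowerSeries K} (hu : psRes K u ≠ 0)
    (hv : psRes K v ≠ 0) (h : tvar K ^ a * psToL K u = tvar K ^ b * psToL K v) : a = b := by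
  have key : ∀ {a b : ℤ} {u v : PowerSeries K}, psRes K u ≠ 0 →
      tvar K ^ a * psToL K u = tvar K ^ b * psToL K v → b ≤ a := by
    intro a b u v hu h
    by_contra hab
    obtain ⟨j, hj⟩ := Int.eq_ofNat_of_zero_le (show 0 ≤ b - a - 1 by omega)
    have hb : b = a + ((j + 1 : ℕ) : ℤ) := by push_cast; omega
    rw [hb, zpow_add₀ tvar_ne_zero, mul_assoc, tvar_zpow_natCast, ← map_mul] at h
    have h1 := psToL_injective (mul_left_cancel₀ (zpow_ne_zero _ tvar_ne_zero) h)
    apply hu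
    rw [h1, map_mul, map_pow, psRes_X]
    simp
  exact le_antisymm (key hv h.symm) (key hu h)

variable {c d : K}

/-- Power series with coefficients in `(c, d)_K`, as a subring of Laurent series. -/
noncomputable def qToL : ℍ[PowerSeries K, PowerSeries.C c, PowerSeries.C d] →+*
    ℍ[LaurentSeries K, (HahnSeries.C c : LaurentSeries K), (HahnSeries.C d : LaurentSeries K)] :=
  qmap (psToL K) (psToL_C c) (psToL_C d)

/-- The residue at `0`. -/
noncomputable def qRes : ℍ[PowerSeries K, PowerSeries.C c, PowerSeries.C d] →+* ℍ[K, c, d] :=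
  qmap (psRes K) (psRes_C c) (psRes_C d)

/-- Constant power series. -/
noncomputable def qConst : ℍ[K, c, d] →+* ℍ[PowerSeries K, PowerSeries.C c, PowerSeries.C d] :=
  qmap PowerSeries.C rfl rfl

/-- Constant Laurent series. -/
noncomputable def qConstL : ℍ[K, c, d] →+*
    ℍ[LaurentSeries K, (HahnSeries.C c : LaurentSeries K), (HahnSeries.C d : LaurentSeries K)] :=
  qmap HahnSeries.C rfl rfl

theorem qRes_qConst (x : ℍ[K, c, d]) : qRes (qConst x) = x := by
  ext <;> exact psRes_C _

theorem qToL_qConst (x : ℍ[K, c, d]) : qToL (qConst x) = qConstL x := by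
  ext : 1 <;> exact psToL_C _

theorem qToL_injective : Function.Injective (qToL (c := c) (d := d)) :=
  qmap_injective _ _ _ psToL_injective

theorem qToL_smul (r : PowerSeries K) (x : ℍ[PowerSeries K, PowerSeries.C c, PowerSeries.C d]) :
    qToL (r • x) = psToL K r • qToL x := qmap_smul _ _ _ r x

theorem qRes_smul (r : PowerSeries K) (x : ℍ[PowerSeries K, PowerSeries.C c, PowerSeries.C d]) :
    qRes (r • x) = psRes K r • qRes x := qmap_smul _ _ _ r x

theorem qRes_star (x : ℍ[PowerSeries K, PowerSeries.C c, PowerSeries.C d]) :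
    qRes (star x) = star (qRes x) := qmap_star _ _ _ x

theorem exists_X_smul_of_qRes {x : ℍ[PowerSeries K, PowerSeries.C c, PowerSeries.C d]}
    (h : qRes x = 0) : ∃ y, x = (PowerSeries.X : PowerSeries K) • y := by
  obtain ⟨y₁, h₁⟩ := exists_X_mul_of_psRes (congrArg QuaternionAlgebra.re h)
  obtain ⟨y₂, h₂⟩ := exists_X_mul_of_psRes (congrArg QuaternionAlgebra.imI h)
  obtain ⟨y₃, h₃⟩ := exists_X_mul_of_psRes (congrArg QuaternionAlgebra.imJ h)
  obtain ⟨y₄, h₄⟩ := exists_X_mul_of_psRes (congrArg QuaternionAlgebra.imK h)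
  exact ⟨⟨y₁, y₂, y₃, y₄⟩, QuaternionAlgebra.ext h₁ h₂ h₃ h₄⟩

theorem X_smul_cancel {x y : ℍ[PowerSeries K, PowerSeries.C c, PowerSeries.C d]}
    (h : (PowerSeries.X : PowerSeries K) • x = (PowerSeries.X : PowerSeries K) • y) : x = y := by
  have hX : (PowerSeries.X : PowerSeries K) ≠ 0 := PowerSeries.X_ne_zero
  ext : 1
  · exact mul_left_cancel₀ hX (congrArg QuaternionAlgebra.re h)
  · exact mul_left_cancel₀ hX (congrArg QuaternionAlgebra.imI h)
  · exact mul_left_cancel₀ hX (congrArg QuaternionAlgebra.imJ h)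
  · exact mul_left_cancel₀ hX (congrArg QuaternionAlgebra.imK h)

theorem exists_normalize_quaternion {κ : Type*} [Finite κ]
    (x : κ → ℍ[LaurentSeries K, (HahnSeries.C c : LaurentSeries K),
      (HahnSeries.C d : LaurentSeries K)]) (hx : ∃ k, x k ≠ 0) :
    ∃ (m : ℤ) (y : κ → ℍ[PowerSeries K, PowerSeries.C c, PowerSeries.C d]),
      (∀ k, x k = tvar K ^ m • qToL (y k)) ∧ ∃ k, qRes (y k) ≠ 0 := by
  obtain ⟨m, y, hy, ⟨k, i⟩, hk⟩ := exists_normalize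
    (fun k : κ × Fin 4 => QuaternionAlgebra.equivTuple _ _ _ (x k.1) k.2) (by
      by_contra h
      push Not at h
      obtain ⟨k, hk⟩ := hx
      refine hk ((QuaternionAlgebra.equivTuple _ _ _).injective ?_)
      funext i
      rw [h (k, i)]
      fin_cases i <;> rfl)
  refine ⟨m, fun k => (QuaternionAlgebra.equivTuple _ _ _).symm fun i => y (k, i), ?_, k, ?_⟩
  · intro k
    ext : 1
    exacts [hy (k, 0), hy (k, 1), hy (k, 2), hy (k, 3)]
  · intro h
    apply hk
    fin_cases i
    exacts [congrArg QuaternionAlgebra.re h, congrArg QuaternionAlgebra.imI h,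
      congrArg QuaternionAlgebra.imJ h, congrArg QuaternionAlgebra.imK h]

/-- The norm form of a quaternion division algebra stays anisotropic over Laurent series. -/
theorem qnorm_anisotropic_laurent (hQ : ∀ x : ℍ[K, c, d], qnorm x = 0 → x = 0)
    (x : ℍ[LaurentSeries K, (HahnSeries.C c : LaurentSeries K),
      (HahnSeries.C d : LaurentSeries K)]) (hx : qnorm x = 0) : x = 0 := by
  by_contra h
  obtain ⟨m, y, hy, k, hk⟩ := exists_normalize_quaternion (fun _ : Unit => x) ⟨(), h⟩
  rw [hy k, qnorm_smul, qToL, qnorm_qmap] at hx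
  have h1 := (mul_eq_zero.1 hx).resolve_left (pow_ne_zero _ (zpow_ne_zero _ tvar_ne_zero))
  rw [map_eq_zero_iff _ psToL_injective] at h1
  exact hk (hQ _ (by rw [qRes, qnorm_qmap, h1, map_zero]))

/-- After factoring `tᵐ` out of `x`, anisotropy of the residue norm makes the remaining norm a unit.
So `Nrd x` has order `2m`, and comparing orders gives `4m = 2k`. -/
theorem even_of_qnorm_sq_eq (hQ : ∀ x : ℍ[K, c, d], qnorm x = 0 → x = 0)
    {x : ℍ[LaurentSeries K, (HahnSeries.C c : LaurentSeries K),
      (HahnSeries.C d : LaurentSeries K)]} {k : ℤ} {u : PowerSeries K} (hu : psRes K u ≠ 0)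
    (hx : qnorm x ^ 2 = (tvar K ^ k * psToL K u) ^ 2) : Even k := by
  have hu0 : psToL K u ≠ 0 := by
    rw [Ne, map_eq_zero_iff _ psToL_injective]
    rintro rfl
    exact hu (map_zero _)
  have h : x ≠ 0 := by
    rintro rfl
    rw [qnorm_zero, zero_pow two_ne_zero] at hx
    exact pow_ne_zero 2 (mul_ne_zero (zpow_ne_zero k tvar_ne_zero) hu0) hx.symm
  obtain ⟨m, y, hy, i, hi⟩ := exists_normalize_quaternion (fun _ : Unit => x) ⟨(), h⟩
  have hv : psRes K (qnorm (y i)) ≠ 0 := by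
    intro h1
    exact hi (hQ _ (by rw [qRes, qnorm_qmap, h1]))
  rw [hy i, qnorm_smul, qToL, qnorm_qmap, mul_pow, mul_pow, ← pow_mul, ← map_pow, ← map_pow,
    ← zpow_natCast, ← zpow_natCast, ← zpow_mul, ← zpow_mul] at hx
  have := zpow_tvar_unique (by rw [map_pow]; exact pow_ne_zero 2 hv)
    (by rw [map_pow]; exact pow_ne_zero 2 hu) hx
  push_cast at this
  exact ⟨m, by omega⟩

end Laurent

/-! ### Similitudes of `D ⊥ ⟨t q⟩` over Laurent series -/

section Step

variable {K : Type*} [Field K] {c d : K} {n : ℕ}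

/-- The coefficients of `D ⊥ ⟨X q⟩` over power series. -/
noncomputable def psForm (D : Fin n → ℍ[K, c, d]) (q : ℍ[K, c, d]) :
    Fin (n + 1) → ℍ[PowerSeries K, PowerSeries.C c, PowerSeries.C d] :=
  Fin.snoc (α := fun _ => ℍ[PowerSeries K, PowerSeries.C c, PowerSeries.C d])
    (fun i => qConst (D i)) ((PowerSeries.X : PowerSeries K) • qConst q)

/-- The coefficients of `D ⊥ ⟨t q⟩` over Laurent series. -/
noncomputable def laurentForm (D : Fin n → ℍ[K, c, d]) (q : ℍ[K, c, d]) (i : Fin (n + 1)) :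
    ℍ[LaurentSeries K, (HahnSeries.C c : LaurentSeries K), (HahnSeries.C d : LaurentSeries K)] :=
  qToL (psForm D q i)

variable {D : Fin n → ℍ[K, c, d]} {q : ℍ[K, c, d]}

@[simp] theorem psForm_castSucc (i : Fin n) : psForm D q i.castSucc = qConst (D i) :=
  Fin.snoc_castSucc _ _ _

@[simp] theorem psForm_last :
    psForm D q (Fin.last n) = (PowerSeries.X : PowerSeries K) • qConst q :=
  Fin.snoc_last _ _

theorem laurentForm_castSucc (i : Fin n) : laurentForm D q i.castSucc = qConstL (D i) := by
  rw [laurentForm, psForm_castSucc, qToL_qConst]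

theorem laurentForm_last : laurentForm D q (Fin.last n) = tvar K • qConstL q := by
  rw [laurentForm, psForm_last, qToL_smul, psToL_X, qToL_qConst]

theorem hform_laurentForm
    (x y : Fin (n + 1) → ℍ[PowerSeries K, PowerSeries.C c, PowerSeries.C d]) :
    hform (laurentForm D q) (fun i => qToL (x i)) (fun i => qToL (y i)) =
      qToL (hform (psForm D q) x y) := hform_qmap _ _ _ _ _ _

theorem hform_psForm
    (x y : Fin (n + 1) → ℍ[PowerSeries K, PowerSeries.C c, PowerSeries.C d]) :
    hform (psForm D q) x y = hform (fun i => qConst (D i)) (fun i => x i.castSucc)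
      (fun i => y i.castSucc) + (PowerSeries.X : PowerSeries K) •
        (star (x (Fin.last n)) * qConst q * y (Fin.last n)) := by
  rw [hform_succ]
  simp only [psForm_castSucc, psForm_last, mul_smul_comm, smul_mul_assoc]

theorem qRes_hform_qConst (x y : Fin n → ℍ[PowerSeries K, PowerSeries.C c, PowerSeries.C d]) :
    qRes (hform (fun i => qConst (D i)) x y) =
      hform D (fun i => qRes (x i)) (fun i => qRes (y i)) := by
  simp only [hform, map_sum, map_mul, qRes_star, qRes_qConst]

theorem qRes_hform_psForm
    (x y : Fin (n + 1) → ℍ[PowerSeries K, PowerSeries.C c, PowerSeries.C d]) :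
    qRes (hform (psForm D q) x y) =
      hform D (fun i => qRes (x i.castSucc)) (fun i => qRes (y i.castSucc)) := by
  rw [hform_psForm, map_add, qRes_hform_qConst, qRes_smul, psRes_X, zero_smul, add_zero]

/-- Modulo `X` the summand `⟨X q⟩` disappears, so the residues of the first `n` coordinates form an
isotropic vector of `D`. -/
theorem qRes_castSucc_eq_zero (hD : ∀ x, hform D x x = 0 → x = 0)
    {x : Fin (n + 1) → ℍ[PowerSeries K, PowerSeries.C c, PowerSeries.C d]}
    {b : ℍ[PowerSeries K, PowerSeries.C c, PowerSeries.C d]}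
    (h : hform (psForm D q) x x = (PowerSeries.X : PowerSeries K) • b) (i : Fin n) :
    qRes (x i.castSucc) = 0 := by
  have h1 := congrArg qRes h
  rw [qRes_hform_psForm, qRes_smul, psRes_X, zero_smul] at h1
  exact congrFun (hD _ h1) i

/-- The second half of Springer's argument. The first `n` coordinates are divisible by `X` and
contribute a multiple of `X²`; dividing by `X` and reducing leaves only the form `⟨q⟩` at the last
residue. -/
theorem qRes_eq_zero (hQ : ∀ x : ℍ[K, c, d], qnorm x = 0 → x = 0) (hq : q ≠ 0)
    (hD : ∀ x, hform D x x = 0 → x = 0)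
    {x : Fin (n + 1) → ℍ[PowerSeries K, PowerSeries.C c, PowerSeries.C d]}
    {b : ℍ[PowerSeries K, PowerSeries.C c, PowerSeries.C d]}
    (h : hform (psForm D q) x x = (PowerSeries.X : PowerSeries K) •
      (PowerSeries.X : PowerSeries K) • b) (i : Fin (n + 1)) : qRes (x i) = 0 := by
  have h1 := qRes_castSucc_eq_zero hD h
  refine Fin.lastCases ?_ h1 i
  choose y hy using fun i => exists_X_smul_of_qRes (h1 i)
  rw [hform_psForm] at h
  simp only [hy] at h
  rw [hform_smul_smul, mul_smul, ← smul_add] at h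
  have h3 := congrArg qRes (X_smul_cancel h)
  rw [map_add, qRes_smul, qRes_smul, psRes_X, zero_smul, zero_smul, zero_add, map_mul, map_mul,
    qRes_star, qRes_qConst] at h3
  rcases mul_eq_zero_of_anisotropic hQ h3 with h4 | h4
  · rcases mul_eq_zero_of_anisotropic hQ h4 with h5 | h5
    · exact star_eq_zero.1 h5
    · exact absurd h5 hq
  · exact h4

theorem hform_anisotropic_laurent (hQ : ∀ x : ℍ[K, c, d], qnorm x = 0 → x = 0) (hq : q ≠ 0)
    (hD : ∀ x, hform D x x = 0 → x = 0) (x) (hx : hform (laurentForm D q) x x = 0) : x = 0 := by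
  by_contra h
  obtain ⟨m, y, hy, i, hi⟩ := exists_normalize_quaternion x (Function.ne_iff.1 h)
  rw [funext hy, hform_smul_smul, hform_laurentForm] at hx
  have h1 := (smul_eq_zero.1 hx).resolve_left
    (mul_ne_zero (zpow_ne_zero _ tvar_ne_zero) (zpow_ne_zero _ tvar_ne_zero))
  rw [map_eq_zero_iff _ qToL_injective] at h1
  exact hi (qRes_eq_zero hQ hq hD (b := 0) (by rw [h1, smul_zero, smul_zero]) i)

/-- A vector on which the form takes an integral value is integral. -/
theorem exists_integral (hQ : ∀ x : ℍ[K, c, d], qnorm x = 0 → x = 0) (hq : q ≠ 0)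
    (hD : ∀ x, hform D x x = 0 → x = 0) (x)
    (b : ℍ[PowerSeries K, PowerSeries.C c, PowerSeries.C d])
    (hx : hform (laurentForm D q) x x = qToL b) :
    ∃ y : Fin (n + 1) → ℍ[PowerSeries K, PowerSeries.C c, PowerSeries.C d],
      x = fun i => qToL (y i) := by
  by_cases h : x = 0
  · exact ⟨fun _ => 0, by rw [h]; funext i; simp⟩
  obtain ⟨m, y, hy, i, hi⟩ := exists_normalize_quaternion x (Function.ne_iff.1 h)
  by_cases hm : 0 ≤ m
  · obtain ⟨j, rfl⟩ := Int.eq_ofNat_of_zero_le hm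
    refine ⟨fun k => (PowerSeries.X ^ j : PowerSeries K) • y k, ?_⟩
    funext k
    rw [hy, tvar_zpow_natCast, qToL_smul]
  · exfalso
    -- If `m < 0` then `-2m ≥ 2`, so the value `X^(-2m) b` of the form at the normalized vector is
    -- divisible by `X²`, which forces all its residues to vanish.
    obtain ⟨j, hj⟩ := Int.eq_ofNat_of_zero_le (show 0 ≤ -(m + m) - 2 by omega)
    rw [funext hy, hform_smul_smul, hform_laurentForm, ← zpow_add₀ tvar_ne_zero] at hx
    have h1 : hform (psForm D q) y y = (PowerSeries.X : PowerSeries K) •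
        (PowerSeries.X : PowerSeries K) • (PowerSeries.X ^ j : PowerSeries K) • b := by
      apply qToL_injective
      have ht : tvar K * (tvar K * (tvar K ^ (j : ℤ) * tvar K ^ (m + m))) = 1 := by
        rw [← zpow_add₀ tvar_ne_zero, ← zpow_one_add₀ tvar_ne_zero, ← zpow_one_add₀ tvar_ne_zero,
          show 1 + (1 + ((j : ℤ) + (m + m))) = 0 by omega, zpow_zero]
      rw [qToL_smul, qToL_smul, qToL_smul, ← hx, ← tvar_zpow_natCast, psToL_X, smul_smul, smul_smul,
        smul_smul, mul_assoc, mul_assoc, ht, one_smul]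
    exact hi (qRes_eq_zero hQ hq hD h1 i)

/-- Each column of `g` takes the integral value `u D j`, so the integrality of single vectors
applies column by column. -/
theorem IsSim.exists_integral (hQ : ∀ x : ℍ[K, c, d], qnorm x = 0 → x = 0) (hq : q ≠ 0)
    (hD : ∀ x, hform D x x = 0 → x = 0) {g : Matrix (Fin (n + 1)) (Fin (n + 1))
      ℍ[LaurentSeries K, (HahnSeries.C c : LaurentSeries K), (HahnSeries.C d : LaurentSeries K)]}
    {u : PowerSeries K} (h : IsSim (laurentForm D q) g (psToL K u)) :
    ∃ g' : Matrix (Fin (n + 1)) (Fin (n + 1)) ℍ[PowerSeries K, PowerSeries.C c, PowerSeries.C d],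
      g = g'.map qToL ∧ IsSim (psForm D q) g' u := by
  have h1 : ∀ j, ∃ y : Fin (n + 1) → ℍ[PowerSeries K, PowerSeries.C c, PowerSeries.C d],
      (fun i => g i j) = fun i => qToL (y i) := by
    intro j
    refine GenericSum.exists_integral hQ hq hD _ (u • psForm D q j) ?_
    rw [h j j, if_pos rfl, qToL_smul]; rfl
  choose y hy using h1
  refine ⟨Matrix.of fun i j => y j i, Matrix.ext fun i j => congrFun (hy j) i, ?_⟩
  intro j k
  apply qToL_injective
  rw [← hform_laurentForm]
  have h2 := h j k
  rw [hy j, hy k] at h2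
  refine h2.trans ?_
  split_ifs
  · rw [qToL_smul]; rfl
  · rw [map_zero]

/-- The residue of a similitude whose multiplier is a unit. -/
theorem IsSim.residue (h2 : (2 : K) ≠ 0) (hQ : ∀ x : ℍ[K, c, d], qnorm x = 0 → x = 0)
    (hD : ∀ x, hform D x x = 0 → x = 0)
    {g : Matrix (Fin (n + 1)) (Fin (n + 1)) ℍ[PowerSeries K, PowerSeries.C c, PowerSeries.C d]}
    {u : PowerSeries K} (h : IsSim (psForm D q) g u) :
    ∃ (A : Matrix (Fin n) (Fin n) ℍ[K, c, d]) (e : ℍ[K, c, d]),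
      IsSim D A (psRes K u) ∧ star e * q * e = psRes K u • q ∧
      psRes K (nrd g) = nrd A * qnorm e ∧
      ∀ l : PowerSeries K, g * g = l • (1 : Matrix (Fin (n + 1)) (Fin (n + 1)) _) →
        A * A = psRes K l • (1 : Matrix (Fin n) (Fin n) ℍ[K, c, d]) ∧
          e * e = algebraMap K _ (psRes K l) := by
  have hd := (ne_zero_of_anisotropic hQ).2
  -- The last column takes a value divisible by `X`, so `g` modulo `X` is block lower triangular.
  -- Everything else is read off its two diagonal blocks.
  have hz : ∀ i : Fin n, qRes (g i.castSucc (Fin.last n)) = 0 := by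
    refine qRes_castSucc_eq_zero hD (q := q) (x := fun i => g i (Fin.last n))
      (b := u • qConst q) ?_
    rw [h, if_pos rfl, psForm_last, smul_comm]
  refine ⟨Matrix.of fun i j => qRes (g i.castSucc j.castSucc), qRes (g (Fin.last n) (Fin.last n)),
    ?_, ?_, ?_, ?_⟩
  · intro j k
    have h1 := congrArg qRes (h j.castSucc k.castSucc)
    rw [qRes_hform_psForm] at h1
    refine h1.trans ?_
    simp only [Fin.castSucc_inj]
    split_ifs
    · rw [qRes_smul, psForm_castSucc, qRes_qConst]
    · rw [map_zero]
  -- The entries above the corner contribute a multiple of `X²` to the value of the last column;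
  -- after division by `X` only the corner entry survives in the residue.
  · choose y hy using fun i => exists_X_smul_of_qRes (hz i)
    have h1 := h (Fin.last n) (Fin.last n)
    rw [hform_psForm, if_pos rfl, psForm_last, smul_comm u] at h1
    simp only [hy] at h1
    rw [hform_smul_smul, mul_smul, ← smul_add] at h1
    have h3 := congrArg qRes (X_smul_cancel h1)
    rwa [map_add, qRes_smul, psRes_X, zero_smul, zero_add, map_mul, map_mul, qRes_star,
      qRes_smul, qRes_qConst] at h3
  · have h1 : psRes K (nrd g) = nrd (g.map qRes) := (nrd_map _ _ _ g).symm
    rw [h1, nrd_succ h2 hd _ hz]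
    rfl
  · intro l hl
    have hsum : ∀ i j, qRes ((g * g) i j) = ∑ k : Fin n, qRes (g i k.castSucc) *
        qRes (g k.castSucc j) + qRes (g i (Fin.last n)) * qRes (g (Fin.last n) j) := by
      intro i j
      rw [Matrix.mul_apply, map_sum, Fin.sum_univ_castSucc]
      simp only [map_mul]
    have hone : ∀ i j, qRes ((g * g) i j) =
        if i = j then algebraMap K ℍ[K, c, d] (psRes K l) else 0 := by
      intro i j
      rw [hl, Matrix.smul_apply, qRes_smul, Matrix.one_apply]
      split_ifs
      · rw [map_one, Algebra.algebraMap_eq_smul_one]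
      · rw [map_zero, smul_zero]
    constructor
    · refine Matrix.ext fun i j => ?_
      have h3 := hone i.castSucc j.castSucc
      rw [hsum, hz, zero_mul, add_zero] at h3
      rw [Matrix.mul_apply, Matrix.smul_apply, Matrix.one_apply]
      refine h3.trans ?_
      simp only [Fin.castSucc_inj]
      split_ifs
      · rw [Algebra.algebraMap_eq_smul_one]
      · rw [smul_zero]
    · have h3 := hone (Fin.last n) (Fin.last n)
      rw [hsum, if_pos rfl] at h3
      simpa [hz] using h3

/-- The multiplier of a similitude of `D ⊥ ⟨t q⟩` has even order if `D` has rank at least `2`. -/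
theorem IsSim.not_odd (hQ : ∀ x : ℍ[K, c, d], qnorm x = 0 → x = 0) (hq : q ≠ 0)
    (hD : ∀ x, hform D x x = 0 → x = 0)
    {i₀ i₁ : Fin n} (hi : i₀ ≠ i₁)
    {g : Matrix (Fin (n + 1)) (Fin (n + 1)) ℍ[PowerSeries K, PowerSeries.C c, PowerSeries.C d]}
    {u : PowerSeries K} (hu : psRes K u ≠ 0) :
    ¬ IsSim (psForm D q) g (PowerSeries.X * u) := by
  intro h
  -- With a multiplier of order one, the first `n` columns take values divisible by `X`, so the
  -- whole `D`-block vanishes modulo `X`.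
  have hz : ∀ i j : Fin n, qRes (g i.castSucc j.castSucc) = 0 := by
    intro i j
    refine qRes_castSucc_eq_zero hD (q := q) (x := fun i => g i j.castSucc)
      (b := u • qConst (D j)) ?_ i
    rw [h, if_pos rfl, psForm_castSucc, mul_smul]
  choose y hy using fun i j => exists_X_smul_of_qRes (hz i j)
  -- Dividing by `X`, the residues of the last row would be pairwise orthogonal nonzero vectors of
  -- the one-dimensional form `⟨q⟩`. Two indices suffice for a contradiction.
  have h1 : ∀ j k : Fin n, star (qRes (g (Fin.last n) j.castSucc)) * q *
      qRes (g (Fin.last n) k.castSucc) = if j = k then psRes K u • D j else 0 := by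
    intro j k
    have h2 := h j.castSucc k.castSucc
    rw [hform_psForm] at h2
    simp only [hy, Fin.castSucc_inj] at h2
    rw [hform_smul_smul, mul_smul, ← smul_add] at h2
    have h3 : (if j = k then (PowerSeries.X * u) • psForm D q j.castSucc else 0) =
        (PowerSeries.X : PowerSeries K) • if j = k then u • psForm D q j.castSucc else 0 := by
      split_ifs
      · rw [mul_smul]
      · rw [smul_zero]
    rw [h3] at h2
    have h4 := congrArg qRes (X_smul_cancel h2)
    rw [map_add, qRes_smul, psRes_X, zero_smul, zero_add, map_mul, map_mul, qRes_star,
      qRes_qConst] at h4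
    rw [h4]
    split_ifs
    · rw [qRes_smul, psForm_castSucc, qRes_qConst]
    · rw [map_zero]
  have hD0 : ∀ i, D i ≠ 0 := by
    intro i hi
    have h5 := hD (Pi.single i 1) (by
      refine Finset.sum_eq_zero fun j _ => ?_
      by_cases hj : j = i
      · subst hj; rw [hi, mul_zero, zero_mul]
      · rw [Pi.single_eq_of_ne hj, mul_zero])
    simpa using congrFun h5 i
  have h6 : ∀ i, qRes (g (Fin.last n) (i : Fin n).castSucc) ≠ 0 := by
    intro i h7
    have := h1 i i
    rw [h7, mul_zero, if_pos rfl] at this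
    exact smul_ne_zero hu (hD0 i) this.symm
  have h8 := h1 i₀ i₁
  rw [if_neg hi] at h8
  rcases mul_eq_zero_of_anisotropic hQ h8 with h9 | h9
  · rcases mul_eq_zero_of_anisotropic hQ h9 with h10 | h10
    · exact h6 _ (star_eq_zero.1 h10)
    · exact hq h10
  · exact h6 _ h9

theorem nrd_smul {R : Type*} [Field R] {c d : R} (h2 : (2 : R) ≠ 0) (hd : d ≠ 0)
    (r : R) (g : Matrix (Fin n) (Fin n) ℍ[R, c, d]) : nrd (r • g) = (r ^ 2) ^ n * nrd g := by
  have : r • g = Matrix.diagonal (fun _ => algebraMap R ℍ[R, c, d] r) * g := by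
    refine Matrix.ext fun i j => ?_
    rw [Matrix.diagonal_mul, Matrix.smul_apply, Algebra.smul_def]
  rw [this, nrd_mul h2 hd, nrd_diagonal]
  simp only [qnorm_algebraMap, Finset.prod_const, Finset.card_univ, Fintype.card_fin]

theorem two_ne_zero_laurent (h2 : (2 : K) ≠ 0) : (2 : LaurentSeries K) ≠ 0 := by
  rw [← map_ofNat (HahnSeries.C : K →+* LaurentSeries K)]
  exact (map_ne_zero _).2 h2

/-- A similitude of `D ⊥ ⟨t q⟩` over Laurent series, whose multiplier has even order, has a
residue which is a similitude of `D` and of `⟨q⟩`. -/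
theorem IsSim.exists_residue (h2 : (2 : K) ≠ 0) (hQ : ∀ x : ℍ[K, c, d], qnorm x = 0 → x = 0)
    (hq : q ≠ 0) (hD : ∀ x, hform D x x = 0 → x = 0) {g : Matrix (Fin (n + 1)) (Fin (n + 1))
      ℍ[LaurentSeries K, (HahnSeries.C c : LaurentSeries K), (HahnSeries.C d : LaurentSeries K)]}
    {m : LaurentSeries K} (h : IsSim (laurentForm D q) g m) {j : ℤ} {u : PowerSeries K}
    (hmu : m = tvar K ^ (j + j) * psToL K u) {η : ℤˣ} (hn : nrd g = (η : ℤ) * m ^ (n + 1)) :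
    ∃ (A : Matrix (Fin n) (Fin n) ℍ[K, c, d]) (e : ℍ[K, c, d]),
      IsSim D A (psRes K u) ∧ star e * q * e = psRes K u • q ∧
      nrd A * qnorm e = (η : ℤ) * psRes K u ^ (n + 1) ∧
      ∀ l : LaurentSeries K, g * g = l • (1 : Matrix (Fin (n + 1)) (Fin (n + 1)) _) →
        ∃ l₀ : PowerSeries K, (tvar K ^ (-j)) ^ 2 * l = psToL K l₀ ∧
          A * A = psRes K l₀ • (1 : Matrix (Fin n) (Fin n) ℍ[K, c, d]) ∧
          e * e = algebraMap K _ (psRes K l₀) := by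
  have hd := (ne_zero_of_anisotropic hQ).2
  -- Scaling `g` by `t⁻ʲ` multiplies its multiplier by `t⁻²ʲ`, which leaves the unit `u`.
  have hsq : (tvar K ^ (-j)) ^ 2 * m = psToL K u := by
    rw [hmu, sq, ← zpow_add₀ tvar_ne_zero, ← mul_assoc, ← zpow_add₀ tvar_ne_zero]
    simp
  have h1 := h.smul (tvar K ^ (-j))
  rw [hsq] at h1
  obtain ⟨g', hg', hs⟩ := h1.exists_integral hQ hq hD
  obtain ⟨A, e, hA, he, hne, hl⟩ := hs.residue h2 hQ hD
  refine ⟨A, e, hA, he, ?_, ?_⟩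
  · rw [← hne]
    have h3 : nrd g' = (η : ℤ) * u ^ (n + 1) := by
      apply psToL_injective
      have h4 : nrd (g'.map qToL) = psToL K (nrd g') := nrd_map _ _ _ g'
      rw [← h4, ← hg', nrd_smul (two_ne_zero_laurent h2) ((map_ne_zero _).2 hd), hn, map_mul,
        map_pow, ← hsq, map_intCast]
      ring
    rw [h3, map_mul, map_pow, map_intCast]
  · intro l hgl
    have h5 : g'.map qToL * g'.map qToL = ((tvar K ^ (-j)) ^ 2 * l) •
        (1 : Matrix (Fin (n + 1)) (Fin (n + 1)) _) := by
      rw [← hg', Matrix.smul_mul, Matrix.mul_smul, hgl, smul_smul, smul_smul, sq, mul_assoc]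
    set l' := (tvar K ^ (-j)) ^ 2 * l
    rw [← Matrix.map_mul] at h5
    have h6 : ∀ i j, qToL ((g' * g') i j) = if i = j then algebraMap _ _ l' else 0 := by
      intro i j
      have := congrFun (congrFun h5 i) j
      rw [Matrix.map_apply, Matrix.smul_apply, Matrix.one_apply] at this
      rw [this]
      split_ifs
      · rw [Algebra.algebraMap_eq_smul_one]
      · rw [smul_zero]
    -- The scalar `l'` is a diagonal entry of the square of an integral matrix, hence is itself
    -- integral.
    set l₀ := ((g' * g') (Fin.last n) (Fin.last n)).re with hl₀
    have h7 : l' = psToL K l₀ := by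
      have := congrArg QuaternionAlgebra.re (h6 (Fin.last n) (Fin.last n))
      rw [if_pos rfl] at this
      exact this.symm
    obtain ⟨h8, h9⟩ := hl l₀ (by
      refine Matrix.ext fun i j => ?_
      apply qToL_injective
      rw [h6, Matrix.smul_apply, Matrix.one_apply, qToL_smul, ← h7]
      split_ifs
      · rw [map_one, Algebra.algebraMap_eq_smul_one]
      · rw [map_zero, smul_zero])
    exact ⟨l₀, h7, h8, h9⟩

theorem IsSim.even_order (hQ : ∀ x : ℍ[K, c, d], qnorm x = 0 → x = 0)
    (hq : q ≠ 0) (hD : ∀ x, hform D x x = 0 → x = 0) (hn : 2 ≤ n)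
    {g : Matrix (Fin (n + 1)) (Fin (n + 1))
      ℍ[LaurentSeries K, (HahnSeries.C c : LaurentSeries K), (HahnSeries.C d : LaurentSeries K)]}
    {m : LaurentSeries K} (h : IsSim (laurentForm D q) g m)
    (k : ℤ) (u : PowerSeries K) (hu : psRes K u ≠ 0) (hku : m = tvar K ^ k * psToL K u) :
    Even k := by
  by_contra hk
  obtain ⟨j, rfl⟩ := Int.not_even_iff_odd.1 hk
  have h1 := h.smul (tvar K ^ (-j))
  have hsq : (tvar K ^ (-j)) ^ 2 * m = psToL K (PowerSeries.X * u) := by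
    rw [hku, map_mul, psToL_X, sq, ← zpow_add₀ tvar_ne_zero, ← mul_assoc,
      ← zpow_add₀ tvar_ne_zero, show -j + -j + (2 * j + 1) = 1 by ring, zpow_one]
  rw [hsq] at h1
  obtain ⟨g', -, hs⟩ := h1.exists_integral hQ hq hD
  exact IsSim.not_odd hQ hq hD (i₀ := ⟨0, by omega⟩) (i₁ := ⟨1, by omega⟩) (by simp) hu hs

/-- The residue of a similitude of a constant form of rank one. -/
theorem exists_residue_rank_one (hQ : ∀ x : ℍ[K, c, d], qnorm x = 0 → x = 0)
    (hq : q ≠ 0) {e : ℍ[LaurentSeries K, (HahnSeries.C c : LaurentSeries K),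
      (HahnSeries.C d : LaurentSeries K)]}
    {m : LaurentSeries K} (h : star e * qConstL q * e = m • qConstL q) {j : ℤ} {u : PowerSeries K}
    (hu : psRes K u ≠ 0) (hmu : m = tvar K ^ (j + j) * psToL K u) :
    ∃ e₀ : ℍ[K, c, d], star e₀ * q * e₀ = psRes K u • q ∧
      (∀ δ : ℤˣ, qnorm e = (δ : ℤ) * m → qnorm e₀ = (δ : ℤ) * psRes K u) ∧
      ∀ (l : LaurentSeries K) (l₀ : PowerSeries K), e * e = algebraMap _ _ l →
        (tvar K ^ (-j)) ^ 2 * l = psToL K l₀ → e₀ * e₀ = algebraMap K _ (psRes K l₀) := by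
  have htz : ∀ k : ℤ, tvar K ^ k ≠ 0 := fun k => zpow_ne_zero _ tvar_ne_zero
  have hqn : qnorm q ≠ 0 := fun h => hq (hQ _ h)
  have hu0 : psToL K u ≠ 0 := by
    rw [Ne, map_eq_zero_iff _ psToL_injective]
    rintro rfl
    exact hu (map_zero _)
  have hsq : qnorm e ^ 2 = m ^ 2 := by
    have h1 := congrArg qnorm h
    rw [qnorm_mul, qnorm_mul, qnorm_star, qnorm_smul, qConstL, qnorm_qmap] at h1
    exact mul_right_cancel₀ ((map_ne_zero _).2 hqn) (by linear_combination h1)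
  have he0 : e ≠ 0 := by
    rintro rfl
    rw [qnorm_zero, zero_pow two_ne_zero, hmu] at hsq
    exact pow_ne_zero 2 (mul_ne_zero (htz _) hu0) hsq.symm
  obtain ⟨k, y, hy, i, hi⟩ := exists_normalize_quaternion (fun _ : Unit => e) ⟨(), he0⟩
  replace hy := hy i
  set y := y i
  have hv : psRes K (qnorm y) ≠ 0 := by
    intro h1
    exact hi (hQ _ (by rw [qRes, qnorm_qmap, h1]))
  have hye : qnorm e = tvar K ^ (k + k) * psToL K (qnorm y) := by
    rw [hy, qnorm_smul, qToL, qnorm_qmap, sq, ← zpow_add₀ tvar_ne_zero]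
  -- From `Nrd(e)² = m²` the orders satisfy `4k = 4j`, so the factor `tʲ` that normalizes the
  -- multiplier also normalizes `e`.
  obtain rfl : k = j := by
    rw [hye, hmu, mul_pow, mul_pow, ← map_pow, ← map_pow, sq (tvar K ^ (k + k)),
      sq (tvar K ^ (j + j)), ← zpow_add₀ tvar_ne_zero,
      ← zpow_add₀ tvar_ne_zero] at hsq
    have := zpow_tvar_unique (by rw [map_pow]; exact pow_ne_zero 2 hv)
      (by rw [map_pow]; exact pow_ne_zero 2 hu) hsq
    omega
  refine ⟨qRes y, ?_, ?_, ?_⟩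
  · have h3 : star y * qConst q * y = u • qConst q := by
      apply qToL_injective
      apply smul_right_injective _ (htz (k + k))
      simp only
      rw [qToL_smul, qToL_qConst, smul_smul, ← hmu, ← h, hy, QuaternionAlgebra.star_smul',
        smul_mul_assoc, smul_mul_assoc, mul_smul_comm, smul_smul, ← zpow_add₀ tvar_ne_zero, map_mul,
        map_mul, qToL_qConst, qToL, qmap_star]
    have h4 := congrArg qRes h3
    rwa [map_mul, map_mul, qRes_star, qRes_smul, qRes_qConst] at h4
  · intro δ hδ
    have h3 : qnorm y = (δ : ℤ) * u := by
      apply psToL_injective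
      apply mul_left_cancel₀ (htz (k + k))
      rw [← hye, hδ, hmu, map_mul, map_intCast]
      ring
    rw [qRes, qnorm_qmap, h3, map_mul, map_intCast]
  · intro l l₀ hl hl₀
    have h3 : y * y = algebraMap _ _ l₀ := by
      apply qToL_injective
      have h5 : qToL (algebraMap (PowerSeries K) ℍ[PowerSeries K, PowerSeries.C c, PowerSeries.C d]
          l₀) = algebraMap _ _ (psToL K l₀) := qmap_algebraMap _ _ _ _
      have h6 : qToL y = tvar K ^ (-k) • e := by
        rw [hy, smul_smul, ← zpow_add₀ tvar_ne_zero, neg_add_cancel, zpow_zero, one_smul]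
      rw [map_mul, h5, ← hl₀, h6, smul_mul_assoc, mul_smul_comm, smul_smul, hl, map_mul, sq,
        Algebra.smul_def]
    have h4 := congrArg qRes h3
    rw [map_mul] at h4
    rw [h4]
    exact qmap_algebraMap _ _ _ _

/-- Taking norms gives `Nrd(e)² = m²`, and norms from a division algebra defined over `K` have even
order. -/
theorem even_order_of_rank_one (hQ : ∀ x : ℍ[K, c, d], qnorm x = 0 → x = 0)
    (hq : q ≠ 0) {e : ℍ[LaurentSeries K, (HahnSeries.C c : LaurentSeries K),
      (HahnSeries.C d : LaurentSeries K)]}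
    {m : LaurentSeries K} (h : star e * qConstL q * e = m • qConstL q)
    (k : ℤ) (u : PowerSeries K) (hu : psRes K u ≠ 0) (hku : m = tvar K ^ k * psToL K u) :
    Even k := by
  have hqn : qnorm q ≠ 0 := fun h => hq (hQ _ h)
  have h1 := congrArg qnorm h
  rw [qnorm_mul, qnorm_mul, qnorm_star, qnorm_smul, qConstL, qnorm_qmap] at h1
  refine even_of_qnorm_sq_eq hQ (x := e) hu ?_
  rw [← hku]
  exact mul_right_cancel₀ ((map_ne_zero _).2 hqn) (by linear_combination h1)

end Step

/-! ### Iterated residues -/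

section Iterate

variable {F : Type u} [Field F]

/-- The coefficients `tᵢ qᵢ` over an extension `E : F → K`. -/
def extForm {c d : F} {K : Type u} [Field K] (E : F →+* K) {n : ℕ} (t : Fin n → K)
    (q : Fin n → ℍ[F, c, d]) (i : Fin n) : ℍ[K, E c, E d] :=
  t i • qmap E rfl rfl (q i)

/-- The properties of an extension `E : F → K` with elements `t₁, …, tₙ` that are used for iterated
Laurent series: the quaternion algebra `(c, d)` stays division, the forms `⟨t₁q₁, …, tₙqₙ⟩` are
anisotropic, and similitudes of such a form have residues, which are similitudes of the forms
`⟨qᵢ⟩`, simultaneously with similitudes of forms of rank one defined over `F`. -/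
structure HasResidues (c d : F) {K : Type u} [Field K] (E : F →+* K) {n : ℕ} (t : Fin n → K) :
    Prop where
  anisotropic : ∀ x : ℍ[K, E c, E d], qnorm x = 0 → x = 0
  form_anisotropic : ∀ q : Fin n → ℍ[F, c, d], (∀ i, q i ≠ 0) →
    ∀ x, hform (extForm E t q) x x = 0 → x = 0
  -- The family `p` receives the rank one forms split off at earlier steps. The condition `Nonempty
  -- κ ∨ 3 ≤ n` forces the multiplier to have even order: through a member of the family, or because
  -- rank at least `2` remains once the last coefficient is removed.
  residue : ∀ (q : Fin n → ℍ[F, c, d]), (∀ i, q i ≠ 0) →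
    ∀ {κ : Type} (p : κ → ℍ[F, c, d]), (∀ k, p k ≠ 0) → Nonempty κ ∨ 3 ≤ n →
    ∀ (g : Matrix (Fin n) (Fin n) ℍ[K, E c, E d]) (e : κ → ℍ[K, E c, E d]) (m : K), m ≠ 0 →
    IsSim (extForm E t q) g m →
    (∀ k, star (e k) * qmap E rfl rfl (p k) * e k = m • qmap E rfl rfl (p k)) →
    ∀ (η : ℤˣ) (δ : κ → ℤˣ), nrd g = (η : ℤ) * m ^ n → (∀ k, qnorm (e k) = (δ k : ℤ) * m) →
    ∃ (m₀ : F) (u : Fin n → ℍ[F, c, d]) (ε : Fin n → ℤˣ) (v : κ → ℍ[F, c, d]), m₀ ≠ 0 ∧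
      (∀ i, star (u i) * q i * u i = m₀ • q i ∧ qnorm (u i) = (ε i : ℤ) * m₀) ∧ ∏ i, ε i = η ∧
      (∀ k, star (v k) * p k * v k = m₀ • p k ∧ qnorm (v k) = (δ k : ℤ) * m₀) ∧
      ∀ l : K, g * g = l • (1 : Matrix (Fin n) (Fin n) ℍ[K, E c, E d]) →
        (∀ k, e k * e k = algebraMap K _ l) →
        ∃ l₀ : F, (∀ i, u i * u i = algebraMap F _ l₀) ∧ ∀ k, v k * v k = algebraMap F _ l₀

theorem intUnits_cast_mul_self {R : Type*} [Ring R] (ε : ℤˣ) : ((ε : ℤ) : R) * ((ε : ℤ) : R) = 1 := by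
  rw [← Int.cast_mul, ← Units.val_mul, Int.units_mul_self]; simp

theorem HasResidues.base (h2 : (2 : F) ≠ 0) {c d : F}
    (hQ : ∀ x : ℍ[F, c, d], qnorm x = 0 → x = 0) (t : Fin 0 → F) :
    HasResidues c d (RingHom.id F) t where
  anisotropic := hQ
  form_anisotropic := fun _ _ _ _ => Subsingleton.elim _ _
  residue := by
    intro q hq κ p hp hκ g e m hm hg he η δ hη hδ
    refine ⟨m, Fin.elim0, Fin.elim0, e, hm, fun i => i.elim0, ?_, fun k => ⟨he k, hδ k⟩, ?_⟩
    -- The empty matrix has norm `1`, so `η` has to be the empty product.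
    · rw [show g = 1 from Subsingleton.elim _ _, nrd_one, pow_zero, mul_one] at hη
      rcases Int.units_eq_one_or η with rfl | rfl
      · rfl
      · exfalso
        push_cast at hη
        exact h2 (by linear_combination hη)
    · intro l _ hl
      exact ⟨l, fun i => i.elim0, hl⟩

theorem HasResidues.laurent (h2 : (2 : F) ≠ 0) {c d : F} {K : Type u} [Field K] {E : F →+* K}
    {n : ℕ} {t : Fin n → K} (h : HasResidues c d E t) :
    HasResidues c d ((HahnSeries.C : K →+* LaurentSeries K).comp E)
      (Fin.snoc (α := fun _ => LaurentSeries K) (fun i => (HahnSeries.C (t i) : LaurentSeries K))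
        (tvar K)) := by
  have h2K : (2 : K) ≠ 0 := by
    rw [← map_ofNat E]
    exact (map_ne_zero _).2 h2
  have hqE : ∀ x : ℍ[F, c, d], x ≠ 0 → qmap E rfl rfl x ≠ 0 := fun x hx =>
    (map_ne_zero_iff _ (qmap_injective E rfl rfl E.injective)).2 hx
  have hform : ∀ q : Fin (n + 1) → ℍ[F, c, d],
      extForm ((HahnSeries.C : K →+* LaurentSeries K).comp E)
        (Fin.snoc (α := fun _ => LaurentSeries K) (fun i => (HahnSeries.C (t i) : LaurentSeries K))
        (tvar K)) q =
      laurentForm (extForm E t fun i => q i.castSucc) (qmap E rfl rfl (q (Fin.last n))) := by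
    intro q
    funext i
    refine Fin.lastCases ?_ (fun i => ?_) i
    · rw [laurentForm_last, extForm, Fin.snoc_last]
      rfl
    · rw [laurentForm_castSucc, extForm, Fin.snoc_castSucc, extForm, qConstL, qmap_smul]
      rfl
  refine ⟨qnorm_anisotropic_laurent h.anisotropic, ?_, ?_⟩
  · intro q hq
    rw [hform]
    exact hform_anisotropic_laurent h.anisotropic (hqE _ (hq _))
      (h.form_anisotropic _ fun i => hq _)
  · intro q hq κ p hp hκ g e m hm hg he η δ hη hδ
    rw [hform] at hg
    have hD := h.form_anisotropic (fun i => q i.castSucc) fun i => hq _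
    have hql := hqE _ (hq (Fin.last n))
    obtain ⟨k, u, hku, ⟨⟩, hu⟩ := exists_normalize (fun _ : Unit => m) ⟨(), hm⟩
    replace hku := hku ()
    set u := u ()
    obtain ⟨j, rfl⟩ : Even k := by
      rcases hκ with ⟨⟨k₀⟩⟩ | hn
      · exact even_order_of_rank_one h.anisotropic (hqE _ (hp k₀)) (he k₀) k u hu hku
      · exact hg.even_order h.anisotropic hql hD (by omega) k u hu hku
    obtain ⟨A, e₀, hA, he₀, hne, hl⟩ := hg.exists_residue h2K h.anisotropic hql hD hku hη
    choose f hf hfδ hfl using fun k =>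
      exists_residue_rank_one h.anisotropic (hqE _ (hp k)) (he k) hu hku
    obtain ⟨ε₀, hε₀⟩ := similitude_sign h.anisotropic hql he₀
    -- The form `⟨q_last⟩` with its similitude `e₀` joins the family as `none`. As `nrd A * qnorm e₀
    -- = η uⁿ⁺¹` and `qnorm e₀ = ε₀ u`, the sign left for `A` is `η * ε₀`.
    obtain ⟨m₀, w, ε, v, hm₀, hw, hε, hv, hsq⟩ := h.residue (fun i => q i.castSucc) (fun i => hq _)
      (κ := Option κ) (fun k => k.elim (q (Fin.last n)) p)
      (by rintro (_ | k); exacts [hq _, hp k]) (Or.inl inferInstance) A (fun k => k.elim e₀ f)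
      (psRes K u) hu hA (by rintro (_ | k); exacts [he₀, hf k]) (η * ε₀) (fun k => k.elim ε₀ δ)
      (by
        rw [hε₀] at hne
        apply mul_right_cancel₀ hu
        push_cast
        linear_combination ((ε₀ : ℤ) : K) * hne -
          nrd A * psRes K u * intUnits_cast_mul_self (R := K) ε₀)
      (by rintro (_ | k); exacts [hε₀, hfδ k _ (hδ k)])
    refine ⟨m₀, Fin.snoc (α := fun _ => ℍ[F, c, d]) w (v none),
      Fin.snoc (α := fun _ => ℤˣ) ε ε₀, fun k => v (some k), hm₀, ?_, ?_, fun k => hv (some k), ?_⟩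
    · intro i
      refine Fin.lastCases ?_ (fun i => ?_) i
      · simp only [Fin.snoc_last]
        exact hv none
      · simp only [Fin.snoc_castSucc]
        exact hw i
    · rw [Fin.prod_univ_castSucc]
      simp only [Fin.snoc_last, Fin.snoc_castSucc]
      rw [hε, mul_assoc, Int.units_mul_self, mul_one]
    · intro l hgl hel
      obtain ⟨l₀, hl₀, hAl, hel₀⟩ := hl l hgl
      obtain ⟨l₁, hl₁, hl₂⟩ := hsq (psRes K l₀) hAl
        (by rintro (_ | k); exacts [hel₀, hfl k l l₀ (hel k) hl₀])
      refine ⟨l₁, fun i => ?_, fun k => hl₂ (some k)⟩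
      refine Fin.lastCases ?_ (fun i => ?_) i
      · rw [Fin.snoc_last]
        exact hl₂ none
      · rw [Fin.snoc_castSucc]
        exact hl₁ i

theorem hasResidues_iteratedLaurent (h2 : (2 : F) ≠ 0) {c d : F}
    (hQ : ∀ x : ℍ[F, c, d], qnorm x = 0 → x = 0) :
    ∀ n, HasResidues c d (IteratedLaurent.embed F n) (IteratedLaurent.t F n)
  | 0 => HasResidues.base h2 hQ _
  | n + 1 => (hasResidues_iteratedLaurent h2 hQ n).laurent h2

end Iterate

/-! ### Determinants of split representations -/

section SkolemNoether

/-- An automorphism of a matrix algebra preserves determinants. -/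
theorem det_algEquiv {Ω I : Type*} [Field Ω] [Fintype I] [DecidableEq I]
    (ψ : Matrix I I Ω ≃ₐ[Ω] Matrix I I Ω) (M : Matrix I I Ω) : (ψ M).det = M.det := by
  let L : Matrix I I Ω ≃ₐ[Ω] Module.End Ω (I → Ω) := Matrix.toLinAlgEquiv'
  -- Skolem–Noether: automorphisms of an endomorphism algebra are conjugations.
  obtain ⟨T, hT⟩ := AlgEquiv.eq_linearEquivConjAlgEquiv ((L.symm.trans ψ).trans L)
  have h1 : L (ψ M) = T.conjAlgEquiv Ω (L M) := by
    rw [← hT]; simp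
  have h2 : ∀ N, LinearMap.det (L N) = N.det := fun N => LinearMap.det_toLin' N
  rw [← h2, h1, ← h2]
  exact LinearMap.det_conj (L M) T

/-- Two representations of an algebra by matrices over an extension field, one of which is
spanning, have the same determinants. -/
theorem det_eq_det_of_surjective {K Ω A I : Type*} [Field K] [Field Ω] [Algebra K Ω] [Ring A]
    [Algebra K A] [Module.Finite K A] [Fintype I] [DecidableEq I] [Nonempty I]
    (hA : Module.finrank K A = Fintype.card I * Fintype.card I)
    (φ₀ φ : A →ₐ[K] Matrix I I Ω)
    (hφ₀ : Submodule.span Ω (Set.range φ₀) = ⊤) (x : A) : (φ x).det = (φ₀ x).det := by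
  -- After extension of scalars to `Ω`, `φ₀` is onto by the spanning hypothesis and bijective by
  -- dimension. The extension of `φ` then differs from it by an automorphism of the matrix algebra.
  let ext : (A →ₐ[K] Matrix I I Ω) → (Ω ⊗[K] A →ₐ[Ω] Matrix I I Ω) := fun χ =>
    Algebra.TensorProduct.lift (Algebra.ofId Ω (Matrix I I Ω)) χ
      fun a b => Algebra.commutes a (χ b)
  have hext : ∀ χ a, ext χ (1 ⊗ₜ a) = χ a := by
    intro χ a
    exact (Algebra.TensorProduct.lift_tmul _ _ _ _ _).trans (by rw [map_one, one_mul])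
  have hdim : Module.finrank Ω (Ω ⊗[K] A) = Module.finrank Ω (Matrix I I Ω) := by
    rw [Module.finrank_baseChange, hA, Module.finrank_matrix, Module.finrank_self, mul_one]
  have hsurj : Function.Surjective (ext φ₀) := by
    rw [← AlgHom.range_eq_top, ← Algebra.toSubmodule_eq_top, eq_top_iff, ← hφ₀, Submodule.span_le]
    rintro _ ⟨a, rfl⟩
    exact ⟨1 ⊗ₜ a, hext φ₀ a⟩
  have hinj : Function.Injective (ext φ₀) :=
    (LinearMap.injective_iff_surjective_of_finrank_eq_finrank (f := (ext φ₀).toLinearMap) hdim).2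
      hsurj
  let e := AlgEquiv.ofBijective (ext φ₀) ⟨hinj, hsurj⟩
  let ψ : Matrix I I Ω →ₐ[Ω] Matrix I I Ω := (ext φ).comp e.symm.toAlgHom
  have hψ : Function.Injective ψ := ψ.toRingHom.injective
  let ψ' := AlgEquiv.ofBijective ψ ⟨hψ,
    (LinearMap.injective_iff_surjective_of_finrank_eq_finrank (f := ψ.toLinearMap) rfl).1 hψ⟩
  have h1 : ψ' (φ₀ x) = φ x := by
    have h2 : e.symm (φ₀ x) = 1 ⊗ₜ x := by
      rw [AlgEquiv.symm_apply_eq]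
      exact (hext φ₀ x).symm
    change ext φ (e.symm (φ₀ x)) = φ x
    rw [h2, hext]
  rw [← h1, det_algEquiv]

end SkolemNoether

/-! ### The reduced norm of matrices over a quaternion algebra, via splittings -/

section ReducedNorm

variable {K : Type u} [Field K] {c d : K} {n : ℕ}

/-- The splitting of `M_n((c, d)_K)` over an extension that contains a square root of `c`. -/
noncomputable def splitAlgHom {Ω : Type*} [Field Ω] [Algebra K Ω] (s : Ω)
    (hs : s * s = algebraMap K Ω c) :
    Matrix (Fin n) (Fin n) ℍ[K, c, d] →ₐ[K] Matrix (Fin n × Fin 2) (Fin n × Fin 2) Ω where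
  toRingHom := (quadLift (algebraMap K Ω) s hs).mapMatrix.comp splitMatrix
  commutes' r := by
    refine Matrix.ext ?_
    rintro ⟨i, a⟩ ⟨j, b⟩
    by_cases hij : i = j
    · subst hij
      fin_cases a <;> fin_cases b <;>
        simp [splitMatrix_apply, splitHom_apply, Matrix.algebraMap_matrix_apply, quadLift,
          QuaternionAlgebra.algebraMap_eq]
    · fin_cases a <;> fin_cases b <;>
        simp [splitMatrix_apply, splitHom_apply, Matrix.algebraMap_matrix_apply, quadLift, hij]

theorem splitAlgHom_apply {Ω : Type*} [Field Ω] [Algebra K Ω] (s : Ω)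
    (hs : s * s = algebraMap K Ω c) (g : Matrix (Fin n) (Fin n) ℍ[K, c, d]) (i j : Fin n × Fin 2) :
    splitAlgHom s hs g i j = quadLift (algebraMap K Ω) s hs (splitHom (g i.1 j.1) i.2 j.2) := rfl

theorem det_splitAlgHom (h2 : (2 : K) ≠ 0) (hd : d ≠ 0) {Ω : Type*} [Field Ω] [Algebra K Ω] (s : Ω)
    (hs : s * s = algebraMap K Ω c) (g : Matrix (Fin n) (Fin n) ℍ[K, c, d]) :
    (splitAlgHom s hs g).det = algebraMap K Ω (nrd g) := by
  have : (splitAlgHom s hs g).det = quadLift (algebraMap K Ω) s hs (splitMatrix g).det :=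
    (RingHom.map_det _ _).symm
  rw [this, det_splitMatrix h2 hd]
  simp [quadLift]

theorem span_splitAlgHom (h2 : (2 : K) ≠ 0) (hc : c ≠ 0) (hd : d ≠ 0) {Ω : Type*} [Field Ω]
    [Algebra K Ω] (s : Ω) (hs : s * s = algebraMap K Ω c) :
    Submodule.span Ω (Set.range (splitAlgHom (d := d) (n := n) s hs)) = ⊤ := by
  have h2' : (2 : Ω) ≠ 0 := by
    rw [← map_ofNat (algebraMap K Ω)]
    exact (map_ne_zero _).2 h2
  have hs0 : s ≠ 0 := by
    rintro rfl
    rw [zero_mul] at hs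
    exact hc ((map_eq_zero _).1 hs.symm)
  have hd' : algebraMap K Ω d ≠ 0 := (map_ne_zero _).2 hd
  set S := Submodule.span Ω (Set.range (splitAlgHom (d := d) (n := n) s hs)) with hS
  have hmem : ∀ (i j : Fin n) (r r' : Ω) (x x' : ℍ[K, c, d]),
      r • splitAlgHom s hs (Matrix.single i j x) + r' • splitAlgHom s hs (Matrix.single i j x') ∈ S :=
    fun i j r r' x x' => S.add_mem (S.smul_mem _ (Submodule.subset_span ⟨_, rfl⟩))
      (S.smul_mem _ (Submodule.subset_span ⟨_, rfl⟩))
  have hsingle : ∀ (i j : Fin n) (a b : Fin 2), Matrix.single (i, a) (j, b) (1 : Ω) ∈ S := by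
    intro i j a b
    have hentry : ∀ (x : ℍ[K, c, d]) (k l : Fin n) (a b : Fin 2),
        splitAlgHom s hs (Matrix.single i j x) (k, a) (l, b) =
          if i = k ∧ j = l then quadLift (algebraMap K Ω) s hs (splitHom x a b) else 0 := by
      intro x k l a b
      rw [splitAlgHom_apply, Matrix.single_apply]
      split_ifs
      · rfl
      · simp
    have key : ∀ (r r' : Ω) (x x' : ℍ[K, c, d]),
        (∀ a' b', r * quadLift (algebraMap K Ω) s hs (splitHom x a' b') +
          r' * quadLift (algebraMap K Ω) s hs (splitHom x' a' b') =
            if a = a' ∧ b = b' then 1 else 0) → Matrix.single (i, a) (j, b) (1 : Ω) ∈ S := by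
      intro r r' x x' h
      convert hmem i j r r' x x' using 1
      refine Matrix.ext ?_
      rintro ⟨k, a'⟩ ⟨l, b'⟩
      rw [Matrix.add_apply, Matrix.smul_apply, Matrix.smul_apply, hentry, hentry,
        Matrix.single_apply]
      by_cases hkl : i = k ∧ j = l
      · rw [if_pos hkl, if_pos hkl, smul_eq_mul, smul_eq_mul, h]
        simp [hkl.1, hkl.2, Prod.ext_iff]
      · rw [if_neg hkl, if_neg hkl, smul_zero, smul_zero, add_zero, if_neg]
        rintro ⟨h1, h3⟩
        exact hkl ⟨(Prod.ext_iff.1 h1).1, (Prod.ext_iff.1 h3).1⟩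
    -- The four `2 × 2` matrix units are `(1 ± i/s)/2` on the diagonal, `(j + k/s)/(2d)` above it
    -- and `(j - k/s)/2` below it.
    fin_cases a <;> fin_cases b
    · refine key (2⁻¹) (2⁻¹ * s⁻¹) 1 ⟨0, 1, 0, 0⟩ fun a' b' => ?_
      fin_cases a' <;> fin_cases b' <;> simp [splitHom_apply, quadLift] <;> field_simp <;> ring
    · refine key (2⁻¹ * (algebraMap K Ω d)⁻¹) (2⁻¹ * (algebraMap K Ω d)⁻¹ * s⁻¹) ⟨0, 0, 1, 0⟩
        ⟨0, 0, 0, 1⟩ fun a' b' => ?_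
      fin_cases a' <;> fin_cases b' <;> simp [splitHom_apply, quadLift] <;> field_simp <;> ring
    · refine key (2⁻¹) (-(2⁻¹ * s⁻¹)) ⟨0, 0, 1, 0⟩ ⟨0, 0, 0, 1⟩ fun a' b' => ?_
      fin_cases a' <;> fin_cases b' <;> simp [splitHom_apply, quadLift] <;> field_simp <;> ring
    · refine key (2⁻¹) (-(2⁻¹ * s⁻¹)) 1 ⟨0, 1, 0, 0⟩ fun a' b' => ?_
      fin_cases a' <;> fin_cases b' <;> simp [splitHom_apply, quadLift] <;> field_simp <;> ring
  rw [eq_top_iff]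
  intro M _
  rw [Matrix.matrix_eq_sum_single M]
  refine S.sum_mem fun i _ => S.sum_mem fun j _ => ?_
  have := S.smul_mem (M i j) (hsingle i.1 j.1 i.2 j.2)
  rwa [Matrix.smul_single, smul_eq_mul, mul_one] at this

theorem degree_eq {A : Type*} [Ring A] [Algebra K A]
    (e : A ≃ₐ[K] Matrix (Fin n) (Fin n) ℍ[K, c, d]) : degree K A = n * 2 := by
  rw [degree, e.toLinearEquiv.finrank_eq, Module.finrank_matrix, QuaternionAlgebra.finrank_eq_four,
    Fintype.card_fin, show n * n * 4 = (n * 2) * (n * 2) by ring, Nat.sqrt_eq]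

/-- The reduced norm of `M_n((c, d)_K)`. -/
theorem reducedNorm_eq (h2 : (2 : K) ≠ 0) (hc : c ≠ 0) (hd : d ≠ 0) (hn : n ≠ 0) {A : Type*}
    [Ring A] [Algebra K A] (e : A ≃ₐ[K] Matrix (Fin n) (Fin n) ℍ[K, c, d]) (x : A) :
    reducedNorm K x = nrd (e x) := by
  have : NeZero n := ⟨hn⟩
  let Ω := AlgebraicClosure K
  obtain ⟨s, hs⟩ := IsAlgClosed.exists_pow_nat_eq (algebraMap K Ω c) (n := 2) two_pos
  rw [sq] at hs
  let φ₀ : A →ₐ[K] Matrix (Fin n × Fin 2) (Fin n × Fin 2) Ω :=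
    (splitAlgHom (d := d) (n := n) s hs).comp e.toAlgHom
  have hcard : Fintype.card (Fin n × Fin 2) = n * 2 := by simp
  let r : Fin n × Fin 2 ≃ Fin (degree K A) := Fintype.equivFinOfCardEq (by rw [degree_eq e, hcard])
  let ρ := Matrix.reindexAlgEquiv K Ω r
  have hfin : Module.Finite K A := Module.Finite.equiv e.symm.toLinearEquiv
  have hspan : Submodule.span Ω (Set.range φ₀) = ⊤ := by
    rw [← span_splitAlgHom h2 hc hd s hs]
    congr 1
    exact e.surjective.range_comp (splitAlgHom (d := d) (n := n) s hs)
  have hdet : ∀ φ : A →ₐ[K] Matrix (Fin (degree K A)) (Fin (degree K A)) Ω,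
      (φ x).det = algebraMap K Ω (nrd (e x)) := by
    intro φ
    have h1 := det_eq_det_of_surjective (K := K) (by
      rw [hcard, e.toLinearEquiv.finrank_eq, Module.finrank_matrix,
        QuaternionAlgebra.finrank_eq_four, Fintype.card_fin]
      ring) φ₀ (ρ.symm.toAlgHom.comp φ) hspan x
    have h3 : (φ₀ x).det = algebraMap K Ω (nrd (e x)) := det_splitAlgHom h2 hd s hs (e x)
    rw [← h3, ← h1]
    exact (Matrix.det_submatrix_equiv_self r (φ x)).symm
  have hex : ∃ r : K, ∀ φ : A →ₐ[K] Matrix (Fin (degree K A)) (Fin (degree K A)) Ω,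
      (φ x).det = algebraMap K Ω r := ⟨_, hdet⟩
  rw [reducedNorm, dif_pos hex]
  apply (algebraMap K Ω).injective
  -- The defining condition quantifies over all splittings; one has to exist for it to determine the
  -- chosen value.
  have φ := ρ.toAlgHom.comp φ₀
  rw [← hdet φ]
  exact (hex.choose_spec φ).symm

end ReducedNorm

/-! ### The quaternion algebra over the field of iterated Laurent series -/

section BaseChange

/-- `(c, d)_F ⊗ K = (c, d)_K`. -/
noncomputable def baseChangeHom {F K : Type*} [Field F] [Field K] [Algebra F K] (c d : F) :
    K ⊗[F] ℍ[F, c, d] →ₐ[K] ℍ[K, algebraMap F K c, algebraMap F K d] :=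
  Algebra.TensorProduct.lift (Algebra.ofId K _)
    { qmap (algebraMap F K) rfl rfl with
      commutes' := fun r => (qmap_algebraMap _ _ _ r).trans
        (IsScalarTower.algebraMap_apply F K _ r).symm }
    fun a _ => Algebra.commutes a _

theorem baseChangeHom_tmul {F K : Type*} [Field F] [Field K] [Algebra F K] (c d : F) (r : K)
    (p : ℍ[F, c, d]) : baseChangeHom c d (r ⊗ₜ[F] p) = r • qmap (algebraMap F K) rfl rfl p := by
  rw [Algebra.smul_def]
  exact Algebra.TensorProduct.lift_tmul _ _ _ _ _

theorem baseChangeHom_bijective {F K : Type*} [Field F] [Field K] [Algebra F K] (c d : F) :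
    Function.Bijective (baseChangeHom (K := K) c d) := by
  have hsurj : Function.Surjective (baseChangeHom (K := K) c d) := by
    intro x
    refine ⟨x.re ⊗ₜ 1 + x.imI ⊗ₜ ⟨0, 1, 0, 0⟩ + x.imJ ⊗ₜ ⟨0, 0, 1, 0⟩ + x.imK ⊗ₜ ⟨0, 0, 0, 1⟩, ?_⟩
    simp only [map_add, baseChangeHom_tmul]
    ext <;> simp
  exact ⟨(LinearMap.injective_iff_surjective_of_finrank_eq_finrank
    (f := (baseChangeHom (K := K) c d).toLinearMap) (by
      rw [Module.finrank_baseChange, QuaternionAlgebra.finrank_eq_four,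
        QuaternionAlgebra.finrank_eq_four])).2 hsurj, hsurj⟩

variable {F : Type u} [Field F] {c d : F} {n : ℕ}

variable (c d n) in
/-- The identification of `Q ⊗ F((t₁))…((tₙ))` with a quaternion algebra. -/
noncomputable def quatEquiv : QHat c d n ≃ₐ[IteratedLaurent F n]
    ℍ[IteratedLaurent F n, IteratedLaurent.embed F n c, IteratedLaurent.embed F n d] :=
  AlgEquiv.ofBijective (baseChangeHom (K := IteratedLaurent F n) c d)
    (baseChangeHom_bijective (K := IteratedLaurent F n) c d)

theorem quatEquiv_tmul (r : IteratedLaurent F n) (p : ℍ[F, c, d]) :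
    quatEquiv c d n (QHat.tmul r p) = r • qmap (IteratedLaurent.embed F n) rfl rfl p :=
  baseChangeHom_tmul (K := IteratedLaurent F n) c d r p

theorem quatEquiv_conjHat (x : QHat c d n) :
    quatEquiv c d n (conjHat c d n x) = star (quatEquiv c d n x) := by
  induction x using QHat.induction with
  | zero => rw [map_zero, map_zero, star_zero]
  | add x y hx hy => rw [map_add, map_add, map_add, star_add, hx, hy]
  | tmul r p => rw [conjHat_tmul, quatEquiv_tmul, quatEquiv_tmul, QuaternionAlgebra.star_smul',
      qmap_star]

theorem quatEquiv_coeff (q : Fin n → ℍ[F, c, d]) (i : Fin n) :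
    quatEquiv c d n (coeff q i) =
      extForm (IteratedLaurent.embed F n) (IteratedLaurent.t F n) q i :=
  quatEquiv_tmul _ _

end BaseChange

/-! ### Similitudes as matrix identities, and the center -/

section Matrices

variable {K : Type*} [Field K] {c d : K} {n : ℕ}

theorem conjTranspose_mul_diagonal_mul_apply (D : Fin n → ℍ[K, c, d])
    (g : Matrix (Fin n) (Fin n) ℍ[K, c, d]) (j k : Fin n) :
    (g.conjTranspose * Matrix.diagonal D * g) j k = hform D (fun i => g i j) (fun i => g i k) := by
  rw [Matrix.mul_apply]
  simp only [Matrix.mul_diagonal, Matrix.conjTranspose_apply, hform]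

theorem isSim_iff (D : Fin n → ℍ[K, c, d]) (g : Matrix (Fin n) (Fin n) ℍ[K, c, d]) (m : K) :
    IsSim D g m ↔ g.conjTranspose * Matrix.diagonal D * g = m • Matrix.diagonal D := by
  rw [← Matrix.ext_iff]
  refine forall_congr' fun j => forall_congr' fun k => ?_
  rw [conjTranspose_mul_diagonal_mul_apply, Matrix.smul_apply, Matrix.diagonal_apply, smul_ite,
    smul_zero]

/-- Commuting with the matrix units leaves a scalar matrix `z`; commuting with `i` and `j` removes
the pure part of `z`. -/
theorem exists_eq_smul_one_of_commute (h2 : (2 : K) ≠ 0) (hc : c ≠ 0) (hn : n ≠ 0)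
    (M : Matrix (Fin n) (Fin n) ℍ[K, c, d]) (hM : ∀ N, N * M = M * N) : ∃ l : K, M = l • 1 := by
  obtain ⟨z, rfl⟩ := Matrix.mem_range_scalar_of_commute_single
    (M := M) fun i j _ => hM (Matrix.single i j 1)
  have hz : ∀ x : ℍ[K, c, d], x * z = z * x := by
    intro x
    have h := congrFun (congrFun (hM (Matrix.scalar (Fin n) x)) ⟨0, Nat.pos_of_ne_zero hn⟩)
      ⟨0, Nat.pos_of_ne_zero hn⟩
    rw [← map_mul, ← map_mul] at h
    simpa using h
  have h1 := congrArg QuaternionAlgebra.imJ (hz ⟨0, 1, 0, 0⟩)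
  have h3 := congrArg QuaternionAlgebra.imK (hz ⟨0, 1, 0, 0⟩)
  have h4 := congrArg QuaternionAlgebra.imK (hz ⟨0, 0, 1, 0⟩)
  simp at h1 h3 h4
  have e1 : z.imI = 0 := (mul_eq_zero.1 (show 2 * z.imI = 0 by linear_combination -h4)).resolve_left h2
  have e2 : z.imJ = 0 := (mul_eq_zero.1 (show 2 * z.imJ = 0 by linear_combination h3)).resolve_left h2
  have e3 : z.imK = 0 := (mul_eq_zero.1 (show 2 * c * z.imK = 0 by
    linear_combination h1)).resolve_left (mul_ne_zero h2 hc)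
  refine ⟨z.re, Matrix.ext fun i j => ?_⟩
  have hz' : z = z.re • 1 := by ext <;> simp [e1, e2, e3]
  rw [Matrix.smul_apply, Matrix.scalar_apply, Matrix.diagonal_apply, Matrix.one_apply]
  split_ifs
  · exact hz'
  · rw [smul_zero]

end Matrices

theorem squareClass_mul_sq {K : Type u} [Field K] (x : K) {w : K} (hw : w ≠ 0) :
    squareClass (x * w ^ 2) = squareClass x := by
  ext y
  constructor
  · rintro ⟨z, hz, rfl⟩
    exact ⟨w * z, mul_ne_zero hw hz, by ring⟩
  · rintro ⟨z, hz, rfl⟩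
    exact ⟨z / w, div_ne_zero hz hw, by field_simp⟩

/-! ### Similitudes and the discriminant in terms of matrices over `(c, d)` -/

section Main

variable {F : Type u} [Field F] {c d : F} {n : ℕ}

variable (c d n) in
/-- The identification of `M_n(Q ⊗ F((t₁))…((tₙ)))` with matrices over a quaternion algebra. -/
noncomputable def matEquiv : Matrix (Fin n) (Fin n) (QHat c d n) ≃ₐ[IteratedLaurent F n]
    Matrix (Fin n) (Fin n)
      ℍ[IteratedLaurent F n, IteratedLaurent.embed F n c, IteratedLaurent.embed F n d] :=
  (quatEquiv c d n).mapMatrix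

theorem matEquiv_apply (g : Matrix (Fin n) (Fin n) (QHat c d n)) (i j : Fin n) :
    matEquiv c d n g i j = quatEquiv c d n (g i j) := rfl

/-- The coefficients `tᵢ qᵢ`. -/
noncomputable abbrev diagForm (q : Fin n → ℍ[F, c, d]) :=
  extForm (IteratedLaurent.embed F n) (IteratedLaurent.t F n) q

/-- The relation `σ(g) = D⁻¹ g* D` cleared of the inverse, the form in which the involution is used
below. -/
theorem diagonal_mul_matEquiv_adjointInvolution (q : Fin n → ℍ[F, c, d])
    (hq : ∀ i, IsUnit (q i)) (g : Matrix (Fin n) (Fin n) (QHat c d n)) :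
    Matrix.diagonal (diagForm q) * matEquiv c d n (adjointInvolution q g) =
      (matEquiv c d n g).conjTranspose * Matrix.diagonal (diagForm q) := by
  refine Matrix.ext fun i j => ?_
  rw [Matrix.diagonal_mul, Matrix.mul_diagonal, Matrix.conjTranspose_apply, matEquiv_apply,
    matEquiv_apply, diagForm, ← quatEquiv_coeff, ← quatEquiv_coeff, ← quatEquiv_conjHat, ← map_mul,
    ← map_mul, adjointInvolution, Matrix.of_apply, mul_assoc, Ring.mul_inverse_cancel_left]
  exact isUnit_coeff q hq i

theorem diagForm_ne_zero (q : Fin n → ℍ[F, c, d]) (hq : ∀ i, q i ≠ 0) (i : Fin n) :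
    diagForm q i ≠ 0 :=
  smul_ne_zero (IteratedLaurent.t_ne_zero F n i)
    ((map_ne_zero_iff _ (qmap_injective _ rfl rfl (RingHom.injective _))).2 (hq i))

theorem isSimilitude_iff (hQ : ∀ x : ℍ[IteratedLaurent F n, IteratedLaurent.embed F n c,
    IteratedLaurent.embed F n d], qnorm x = 0 → x = 0) (q : Fin n → ℍ[F, c, d])
    (hq : ∀ i, IsUnit (q i)) (hq0 : ∀ i, q i ≠ 0) (g : (Matrix (Fin n) (Fin n) (QHat c d n))ˣ)
    (m : (IteratedLaurent F n)ˣ) :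
    IsSimilitude (IteratedLaurent F n) (adjointInvolution q) g m ↔
      IsSim (diagForm q) (matEquiv c d n g) m := by
  rw [isSim_iff, ← diagonal_mul_matEquiv_adjointInvolution q hq, mul_assoc, ← map_mul, IsSimilitude]
  constructor
  · intro h
    rw [h, AlgEquiv.commutes, ← Algebra.commutes, Algebra.smul_def]
  · intro h
    apply (matEquiv c d n).injective
    rw [AlgEquiv.commutes]
    rw [Algebra.smul_def, Algebra.commutes] at h
    refine Matrix.ext fun i j => ?_
    have h1 := congrFun (congrFun h i) j
    rw [Matrix.diagonal_mul, Matrix.diagonal_mul] at h1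
    exact mul_left_cancel_of_anisotropic hQ (diagForm_ne_zero q hq0 i) h1

theorem qnorm_diagForm (q : Fin n → ℍ[F, c, d]) (a : Fin n → Fˣ) (hpure : ∀ i, (q i).re = 0)
    (hq : ∀ i, q i * q i = algebraMap F ℍ[F, c, d] (a i : F)) (i : Fin n) :
    qnorm (diagForm q i) =
      IteratedLaurent.t F n i ^ 2 * (-IteratedLaurent.embed F n (a i : F)) := by
  rw [diagForm, extForm, qnorm_smul, qnorm_qmap, qnorm_pure (hpure i) (hq i), map_neg]

theorem degree_div_two (c d : F) :
    degree (IteratedLaurent F n) (Matrix (Fin n) (Fin n) (QHat c d n)) / 2 = n := by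
  rw [degree_eq (matEquiv c d n)]
  simp

theorem star_diagForm (q : Fin n → ℍ[F, c, d]) (hpure : ∀ i, (q i).re = 0) (i : Fin n) :
    star (diagForm q i) = -diagForm q i := by
  rw [diagForm, extForm, QuaternionAlgebra.star_smul', ← qmap_star,
    star_eq_neg_of_re_eq_zero (hpure i), map_neg, smul_neg]

theorem discriminant_eq (h2 : (2 : F) ≠ 0) (hQ : ∀ x : ℍ[F, c, d], qnorm x = 0 → x = 0)
    (hn : n ≠ 0) (q : Fin n → ℍ[F, c, d]) (a : Fin n → Fˣ) (hpure : ∀ i, (q i).re = 0)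
    (hq : ∀ i, q i * q i = algebraMap F ℍ[F, c, d] (a i : F)) (hunit : ∀ i, IsUnit (q i)) :
    discriminant (IteratedLaurent F n) (adjointInvolution q) =
        squareClass (IteratedLaurent.embed F n ((∏ i, a i : Fˣ) : F)) := by
  have hQK := (hasResidues_iteratedLaurent h2 hQ n).anisotropic
  obtain ⟨hc, hd⟩ := ne_zero_of_anisotropic hQK
  have h2K : (2 : IteratedLaurent F n) ≠ 0 := by
    rw [← map_ofNat (IteratedLaurent.embed F n)]
    exact (map_ne_zero _).2 h2
  have hone : ∀ x : Matrix (Fin n) (Fin n) (QHat c d n), IsUnit x → adjointInvolution q x = -x →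
      squareClass ((-1) ^ (degree (IteratedLaurent F n) (Matrix (Fin n) (Fin n) (QHat c d n)) / 2) *
        reducedNorm (IteratedLaurent F n) x) =
        squareClass (IteratedLaurent.embed F n ((∏ i, a i : Fˣ) : F)) := by
    intro x hx hskew
    rw [degree_div_two, reducedNorm_eq h2K hc hd hn (matEquiv c d n)]
    set E := IteratedLaurent.embed F n
    set D := Matrix.diagonal (diagForm q) with hD
    set X := matEquiv c d n x with hX
    have hDs : D.conjTranspose = -D := by
      rw [hD, Matrix.diagonal_conjTranspose, Matrix.diagonal_neg]
      congr 1
      funext i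
      exact star_diagForm q hpure i
    -- `D` is skew-hermitian and `X* D = D σ(X) = -D X`, so `(D X)* = D X`.
    obtain ⟨z, hz⟩ := exists_nrd_hermitian h2K hQK (D * X) (by
      rw [Matrix.conjTranspose_mul, hDs, mul_neg, hX,
        ← diagonal_mul_matEquiv_adjointInvolution q hunit, hskew, map_neg, mul_neg, neg_neg])
    set T := ∏ i, IteratedLaurent.t F n i
    have hT : T ≠ 0 := Finset.prod_ne_zero_iff.2 fun i _ => IteratedLaurent.t_ne_zero F n i
    set α := E ((∏ i, a i : Fˣ) : F) with hα
    have hα0 : α ≠ 0 := (map_ne_zero _).2 (Units.ne_zero _)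
    have hDn : nrd D = T ^ 2 * ((-1) ^ n * α) := by
      rw [hD, nrd_diagonal, Finset.prod_congr rfl fun i _ => qnorm_diagForm q a hpure hq i,
        Finset.prod_mul_distrib, Finset.prod_pow, Finset.prod_neg, Finset.card_univ,
        Fintype.card_fin, hα, Units.coe_prod, map_prod]
    have hX0 : nrd X ≠ 0 := by
      obtain ⟨y, hy⟩ := (hx.map (matEquiv c d n)).exists_right_inv
      intro h
      have := congrArg nrd hy
      rw [nrd_mul h2K hd, ← hX, h, zero_mul, nrd_one] at this
      exact zero_ne_one this
    rw [nrd_mul h2K hd, hDn] at hz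
    have hz0 : z ≠ 0 := by
      rintro rfl
      rw [zero_pow two_ne_zero] at hz
      exact mul_ne_zero (mul_ne_zero (pow_ne_zero _ hT)
        (mul_ne_zero (pow_ne_zero _ (neg_ne_zero.2 one_ne_zero)) hα0)) hX0 hz
    have : (-1) ^ n * nrd X = α * (z / (T * α)) ^ 2 := by
      rw [div_pow, ← hz]
      field_simp
    rw [this, squareClass_mul_sq _ (div_ne_zero hz0 (mul_ne_zero hT hα0))]
  rw [discriminant, Set.iUnion₂_congr (t := fun _ _ =>
    squareClass (IteratedLaurent.embed F n ((∏ i, a i : Fˣ) : F))) fun x hx => hone x hx.1 hx.2]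
  refine Set.biUnion_const ?_ _
  -- The union is over a nonempty set: `D` itself is invertible and `σ`-skew.
  refine ⟨Matrix.diagonal (coeff q), ?_, ?_⟩
  · exact (Pi.isUnit_iff.2 (isUnit_coeff q hunit)).map (Matrix.diagonalRingHom (Fin n) (QHat c d n))
  · refine Matrix.ext fun i j => ?_
    rw [adjointInvolution, Matrix.of_apply, Matrix.neg_apply]
    by_cases hij : i = j
    · subst hij
      rw [Matrix.diagonal_apply_eq, conjHat_coeff q hpure, mul_neg,
        Ring.inverse_mul_cancel _ (isUnit_coeff q hunit i), neg_mul, one_mul]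
    · rw [Matrix.diagonal_apply_ne _ hij, Matrix.diagonal_apply_ne _ (Ne.symm hij), map_zero,
        mul_zero, zero_mul, neg_zero]

/-- The diagonal matrix of rank one similitudes `uᵢ` with the common multiplier `m` has reduced norm
`∏ εᵢ m = -mⁿ`. When every sign is `-1`, each `uᵢ²` is `m`, so its square is the scalar `m`. -/
theorem exists_improper_of_mem_G (h2 : (2 : F) ≠ 0) (hQ : ∀ x : ℍ[F, c, d], qnorm x = 0 → x = 0)
    (hn : n ≠ 0) (q : Fin n → ℍ[F, c, d]) (a : Fin n → Fˣ) (hpure : ∀ i, (q i).re = 0)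
    (hq : ∀ i, q i * q i = algebraMap F ℍ[F, c, d] (a i : F)) (hunit : ∀ i, IsUnit (q i))
    {ε : Fin n → ℤˣ} (hε : ∏ i, ε i = -1) {m : Fˣ} (hm : ∀ i, m ∈ G c d (ε i) (a i)) :
    ∃ g : (Matrix (Fin n) (Fin n) (QHat c d n))ˣ,
      IsImproperSimilitude (IteratedLaurent F n) (adjointInvolution q) g ∧
        ((∀ i, ε i = -1) → IsSquareCentral g) := by
  have hQK := (hasResidues_iteratedLaurent h2 hQ n).anisotropic
  obtain ⟨hc, hd⟩ := ne_zero_of_anisotropic hQK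
  have h2K : (2 : IteratedLaurent F n) ≠ 0 := by
    rw [← map_ofNat (IteratedLaurent.embed F n)]
    exact (map_ne_zero _).2 h2
  choose u hu hun hus using fun i => exists_similitude_of_mem_G h2 hQ (hpure i) (hq i) (hm i)
  set E := IteratedLaurent.embed F n with hE
  set U : Fin n → ℍ[IteratedLaurent F n, E c, E d] := fun i => qmap E rfl rfl (u i) with hU
  have huu : ∀ i, IsUnit (u i) := by
    intro i
    have h0 : qnorm (u i) ≠ 0 := by
      rw [hun i]
      refine mul_ne_zero ?_ m.ne_zero
      rcases Int.units_eq_one_or (ε i) with h | h <;> simp [h]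
    exact ⟨⟨u i, _, mul_inv_smul_star _ h0, inv_smul_star_mul _ h0⟩, rfl⟩
  have hUu : IsUnit (Matrix.diagonal U) :=
    (Pi.isUnit_iff.2 fun i => (huu i).map (qmap E rfl rfl)).map (Matrix.diagonalRingHom (Fin n) _)
  obtain ⟨g, hg⟩ := hUu.map (matEquiv c d n).symm
  have hgU : matEquiv c d n g = Matrix.diagonal U := by rw [hg, AlgEquiv.apply_symm_apply]
  have hEm : ((Units.map (E : F →* IteratedLaurent F n) m : (IteratedLaurent F n)ˣ) :
      IteratedLaurent F n) = E m := rfl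
  refine ⟨g, ⟨Units.map (E : F →* IteratedLaurent F n) m, ?_, ?_⟩, ?_⟩
  · rw [isSimilitude_iff hQK q hunit fun i => pure_ne_zero (hq i), isSim_iff, hgU,
      Matrix.diagonal_conjTranspose, Matrix.diagonal_mul_diagonal, Matrix.diagonal_mul_diagonal,
      ← Matrix.diagonal_smul, hEm]
    congr 1
    funext i
    simp only [Pi.star_apply, Pi.smul_apply, hU, extForm]
    rw [← qmap_star, mul_smul_comm, smul_mul_assoc, ← map_mul, ← map_mul, hu, qmap_smul, smul_comm]
  · rw [reducedNorm_eq h2K hc hd hn (matEquiv c d n), hgU, nrd_diagonal, degree_div_two, hEm,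
      ← map_pow, ← map_neg]
    simp only [hU, qnorm_qmap]
    rw [← map_prod, Finset.prod_congr rfl fun i _ => hun i, Finset.prod_mul_distrib,
      Finset.prod_const, Finset.card_univ, Fintype.card_fin, ← Int.cast_prod, ← Units.coe_prod, hε]
    simp
  · intro hall
    have : (g : Matrix (Fin n) (Fin n) (QHat c d n)) ^ 2 = algebraMap (IteratedLaurent F n) _ (E m) := by
      apply (matEquiv c d n).injective
      rw [map_pow, hgU, AlgEquiv.commutes, Matrix.diagonal_pow, Matrix.algebraMap_eq_diagonal]
      congr 1
      funext i
      simp only [Pi.pow_apply, hU, Pi.algebraMap_apply]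
      rw [sq, ← map_mul, hus i (hall i), qmap_algebraMap]
    rw [IsSquareCentral, this, Subring.mem_center_iff]
    exact fun x => (Algebra.commutes _ x).symm

theorem exists_residue_of_improper (h2 : (2 : F) ≠ 0)
    (hQ : ∀ x : ℍ[F, c, d], qnorm x = 0 → x = 0)
    (hn : 3 ≤ n) (q : Fin n → ℍ[F, c, d]) (a : Fin n → Fˣ) (hpure : ∀ i, (q i).re = 0)
    (hq : ∀ i, q i * q i = algebraMap F ℍ[F, c, d] (a i : F)) (hunit : ∀ i, IsUnit (q i))
    {g : (Matrix (Fin n) (Fin n) (QHat c d n))ˣ}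
    (hg : IsImproperSimilitude (IteratedLaurent F n) (adjointInvolution q) g) :
    ∃ (m : Fˣ) (u : Fin n → ℍ[F, c, d]) (ε : Fin n → ℤˣ), ∏ i, ε i = -1 ∧
      (∀ i, m ∈ G c d (ε i) (a i) ∧ qnorm (u i) = (ε i : ℤ) * (m : F) ∧
        (ε i = -1 → u i * u i = algebraMap F _ (m : F))) ∧
      (IsSquareCentral g → ∃ l : F, ∀ i, u i * u i = algebraMap F _ l) := by
  have HR := hasResidues_iteratedLaurent h2 hQ n
  have hQK := HR.anisotropic
  obtain ⟨hc, hd⟩ := ne_zero_of_anisotropic hQK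
  have h2K : (2 : IteratedLaurent F n) ≠ 0 := by
    rw [← map_ofNat (IteratedLaurent.embed F n)]
    exact (map_ne_zero _).2 h2
  have hn0 : n ≠ 0 := by omega
  have hq0 : ∀ i, q i ≠ 0 := fun i => pure_ne_zero (hq i)
  obtain ⟨μ, hs, hnrd⟩ := hg
  rw [isSimilitude_iff hQK q hunit hq0] at hs
  rw [reducedNorm_eq h2K hc hd hn0 (matEquiv c d n), degree_div_two] at hnrd
  -- The induction starts with no auxiliary rank one forms, so `3 ≤ n` has to provide the even
  -- order; `η = -1` expresses that `g` is improper.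
  obtain ⟨m, u, ε, v, hm, hu, hε, -, hsq⟩ := HR.residue q hq0 (κ := Empty) Empty.elim
    (fun k => k.elim) (Or.inr hn) (matEquiv c d n g) (fun k => k.elim) μ μ.ne_zero hs
    (fun k => k.elim) (-1) (fun k => k.elim) (by rw [hnrd]; simp) (fun k => k.elim)
  refine ⟨Units.mk0 m hm, u, ε, hε, fun i => ?_, fun hcen => ?_⟩
  · have := mem_G_of_similitude h2 hQ (hpure i) (hq i) (m := Units.mk0 m hm) (hu i).1 (hu i).2
    exact ⟨this.1, (hu i).2, this.2⟩
  · obtain ⟨l, hl⟩ := exists_eq_smul_one_of_commute h2K hc hn0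
      (matEquiv c d n g * matEquiv c d n g) (by
        intro N
        have := Subring.mem_center_iff.1 hcen ((matEquiv c d n).symm N)
        have h1 := congrArg (matEquiv c d n) this
        rwa [map_mul, map_mul, AlgEquiv.apply_symm_apply, map_pow, sq] at h1)
    obtain ⟨l₀, h, -⟩ := hsq l hl (fun k => k.elim)
    exact ⟨l₀, h⟩

/-- If `u₁² = … = uₙ²` is a scalar, the signs of the similitudes `uᵢ` of `⟨qᵢ⟩` agree. -/
theorem sign_eq_neg_one (h2 : (2 : F) ≠ 0)
    (hQ : ∀ x : ℍ[F, c, d], qnorm x = 0 → x = 0) {m : Fˣ} {u : Fin n → ℍ[F, c, d]}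
    {ε : Fin n → ℤˣ} (hε : ∏ i, ε i = -1) (hu : ∀ i, qnorm (u i) = (ε i : ℤ) * (m : F))
    (hu' : ∀ i, ε i = -1 → u i * u i = algebraMap F _ (m : F))
    {l : F} (hl : ∀ i, u i * u i = algebraMap F _ l) (i : Fin n) : ε i = -1 := by
  obtain ⟨j, hj⟩ : ∃ j, ε j = -1 := by
    by_contra h
    push Not at h
    have h1 : ∏ i, ε i = 1 :=
      Finset.prod_eq_one fun i _ => (Int.units_eq_one_or (ε i)).resolve_right (h i)
    rw [h1] at hε
    exact absurd hε (by decide)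
  by_contra hi
  have hi1 : ε i = 1 := (Int.units_eq_one_or (ε i)).resolve_right hi
  -- An index with sign `-1` exists because the product is `-1`, and it identifies the common square
  -- with `m`.
  have hlm : l = m := by
    have := (hl j).symm.trans (hu' j hj)
    exact QuaternionAlgebra.algebraMap_injective this
  have hni : qnorm (u i) = m := by rw [hu i, hi1]; simp
  have hnj : qnorm (u j) = -m := by rw [hu j, hj]; simp
  have hui : u i ≠ 0 := by
    intro h
    rw [h, qnorm_zero] at hni
    exact m.ne_zero hni.symm
  -- With sign `+1`, `u i` has both square and norm equal to `m`, so it equals its conjugate and is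
  -- a scalar `x` with `x² = m`.
  have hstar : star (u i) = u i := by
    apply mul_right_cancel_of_anisotropic hQ hui
    rw [star_mul_self_eq, hl i, hlm, hni]
  have hx := eq_algebraMap_of_star_eq h2 hstar
  set x := (u i).re
  have hxm : x ^ 2 = m := by rw [← hni, hx, qnorm_algebraMap]
  -- Then `u j ^ 2 = x ^ 2` forces `u j = ±x` in a division algebra, of norm `m`, whereas sign `-1`
  -- gives norm `-m`.
  have hfac : (u j - algebraMap F _ x) * (u j + algebraMap F _ x) = 0 := by
    have : (u j - algebraMap F ℍ[F, c, d] x) * (u j + algebraMap F _ x) =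
        u j * u j - algebraMap F _ (x ^ 2) := by
      rw [map_pow, sub_mul, mul_add, mul_add, ← Algebra.commutes, sq]
      abel
    rw [this, hl j, hlm, hxm, sub_self]
  have hnj' : qnorm (u j) = m := by
    rcases mul_eq_zero_of_anisotropic hQ hfac with h | h
    · rw [sub_eq_zero.1 h, qnorm_algebraMap, hxm]
    · rw [eq_neg_of_add_eq_zero_left h, qnorm_neg, qnorm_algebraMap, hxm]
  have : 2 * (m : F) = 0 := by linear_combination hnj - hnj'
  exact mul_ne_zero h2 m.ne_zero this

end Main

end GenericSum

/-- `Q = (c, d)_F` is a quaternion division algebra over `F`, `char F ≠ 2`, and the `q i` are pure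
quaternions with `(q i)² = a i ∈ Fˣ`; `σ` is the involution on `M_n(Q ⊗ F((t₁))…((tₙ)))`
adjoint to the skew-hermitian form `⟨t₁q₁, …, tₙqₙ⟩`. -/
theorem mainTheorem4 (F : Type u) [Field F] (hF : ringChar F ≠ 2) (c d : F)
    (hQ : ∀ x : ℍ[F, c, d], x ≠ 0 → IsUnit x)
    (n : ℕ) (hn : 3 ≤ n) (q : Fin n → ℍ[F, c, d]) (a : Fin n → Fˣ)
    (hpure : ∀ i, (q i).re = 0)
    (hq : ∀ i, q i ^ 2 = algebraMap F ℍ[F, c, d] (a i : F)) :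
    GenericSum.discriminant (GenericSum.IteratedLaurent F n) (GenericSum.adjointInvolution q) =
        GenericSum.squareClass
          (algebraMap F (GenericSum.IteratedLaurent F n) ((∏ i, a i : Fˣ) : F)) ∧
    ((∃ g : (Matrix (Fin n) (Fin n) (GenericSum.QHat c d n))ˣ,
        GenericSum.IsImproperSimilitude (GenericSum.IteratedLaurent F n)
          (GenericSum.adjointInvolution q) g) ↔
      ∃ ε : Fin n → ℤˣ, ∏ i, ε i = -1 ∧ (⋂ i, GenericSum.G c d (ε i) (a i)).Nonempty) ∧
    ((∃ g : (Matrix (Fin n) (Fin n) (GenericSum.QHat c d n))ˣ,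
        GenericSum.IsImproperSimilitude (GenericSum.IteratedLaurent F n)
          (GenericSum.adjointInvolution q) g ∧ GenericSum.IsSquareCentral g) ↔
      Odd n ∧ (⋂ i, GenericSum.G c d (-1) (a i)).Nonempty) := by
  have h2 : (2 : F) ≠ 0 := Ring.two_ne_zero hF
  have hQ' := GenericSum.eq_zero_of_qnorm_eq_zero hQ
  have hq' : ∀ i, q i * q i = algebraMap F ℍ[F, c, d] (a i : F) := fun i => by rw [← sq, hq]
  have hunit : ∀ i, IsUnit (q i) := fun i => hQ _ (GenericSum.pure_ne_zero (hq' i))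
  have hn0 : n ≠ 0 := by omega
  refine ⟨GenericSum.discriminant_eq h2 hQ' hn0 q a hpure hq' hunit, ⟨?_, ?_⟩, ⟨?_, ?_⟩⟩
  · rintro ⟨g, hg⟩
    obtain ⟨m, u, ε, hε, hu, -⟩ :=
      GenericSum.exists_residue_of_improper h2 hQ' hn q a hpure hq' hunit hg
    exact ⟨ε, hε, m, Set.mem_iInter.2 fun i => (hu i).1⟩
  · rintro ⟨ε, hε, m, hm⟩
    obtain ⟨g, hg, -⟩ := GenericSum.exists_improper_of_mem_G h2 hQ' hn0 q a hpure hq' hunit hε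
      (Set.mem_iInter.1 hm)
    exact ⟨g, hg⟩
  · rintro ⟨g, hg, hcen⟩
    obtain ⟨m, u, ε, hε, hu, hl⟩ :=
      GenericSum.exists_residue_of_improper h2 hQ' hn q a hpure hq' hunit hg
    obtain ⟨l, hl⟩ := hl hcen
    have hall := GenericSum.sign_eq_neg_one h2 hQ' hε (fun i => (hu i).2.1) (fun i => (hu i).2.2) hl
    refine ⟨?_, m, Set.mem_iInter.2 fun i => hall i ▸ (hu i).1⟩
    rw [Finset.prod_congr rfl fun i _ => hall i, Finset.prod_const, Finset.card_univ,
      Fintype.card_fin] at hε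
    rcases Nat.even_or_odd n with h | h
    · rw [h.neg_one_pow] at hε
      exact absurd hε (by decide)
    · exact h
  · rintro ⟨hodd, m, hm⟩
    obtain ⟨g, hg, hcen⟩ := GenericSum.exists_improper_of_mem_G h2 hQ' hn0 q a hpure hq' hunit
      (ε := fun _ => -1) (by simp [hodd.neg_one_pow]) (Set.mem_iInter.1 hm)
    exact ⟨g, hg, hcen fun _ => rfl⟩
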